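/- **Theorem 2.6 (Forces derived from variation of dissipation energies).** *Setting.* Let $T>0$, let $\Omega\subset\mathbb R^3$ be a bounded domain with smooth boundary, and for $0\le t<T$ let $\Omega_A(t)$ be a bounded domain with $\overline{\Omega_A(t)}\subset\Omega$ whose boundary $\Gamma(t)=\partial\Omega_A(t)$ is a closed smooth surface (with $\Omega_A(t)$ locally on one side). Put $\Omega_B(t)=\Omega\setminus\overline{\Omega_A(t)}$. Let $n_\Gamma={}^t(n_1,n_2,n_3)$ be the unit normal on $\Gamma(t)$ pointing out of $\Omega_A(t)$, $P_\Gamma=I-n_\Gamma\otimes n_\Gamma$, $\partial^\Gamma_jf=\partial_jf-n_j(n_\Gamma\cdot\nabla)f$ (which depends only on $f|_{\Gamma(t)}$, so it is also defined for functions given only on $\Gamma(t)$), $\operatorname{div}_\Gamma V=\sum_j\partial^\Gamma_jV_j$, $\nabla v=(\partial_jv_i)_{ij}$, $\nabla_\Gamma v=(\partial_j^\Gamma v_i)_{ij}$. The divergence of a matrix field is taken row by row: $(\operatorname{div}M)_i=\sum_j\partial_jM_{ij}$, $(\operatorname{div}_\Gamma M)_i=\sum_j\partial^\Gamma_jM_{ij}$.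 Set $$D(v)=\tfrac12\{\nabla v+{}^t(\nabla v)\},\qquad D_\Gamma(v)=\tfrac12\{P_\Gamma\nabla_\Gamma v+{}^t(P_\Gamma\nabla_\Gamma v)\},$$ $M:N=\sum_{i,j}M_{ij}N_{ij}$ and $|M|^2=M:M$. For $\sharp=A,B,S$ let the velocity $v_\sharp$ ($\mathbb R^3$-valued), the viscosities $\mu_\sharp,\lambda_\sharp$ and the pressure $\pi_\sharp$ (real-valued) be smooth functions of $(x,t)\in\mathbb R^4$. Define, for $\sharp=A,B$, $$\mathcal T_\sharp=\mu_\sharp D(v_\sharp)+\lambda_\sharp(\operatorname{div}v_\sharp)I-\pi_\sharp I,\qquad \mathcal T_S=\mu_SD_\Gamma(v_S)+\lambda_S(\operatorname{div}_\Gamma v_S)P_\Gamma-\pi_SP_\Gamma$$ ($\mathcal T_S$ is the Boussinesq–Scriven surface stress), and on $\Gamma(t)$, for $r\in\{0,1\}$ and $\sharp=A,B$, $$\widetilde{\mathcal T}_\sharp=\begin{cases}\mu_\sharp\,n_\Gamma\cdot(n_\Gamma\cdot\nabla)v_\sharp+\lambda_\sharp\operatorname{div}v_\sharp-\pi_\sharp\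 \text{(a scalar)}&\text{if }r=0,\\ \mathcal T_\sharp&\text{if }r=1.\end{cases}$$ For a fixed time $t$ and smooth fields $w_A,w_B,w_S:\mathbb R^3\to\mathbb R^3$ let, with $\mathcal H^2$ the two-dimensional Hausdorff measure (normalized to be surface area), $$E_D[w_A,w_B,w_S]=-\sum_{\sharp=A,B}\int_{\Omega_\sharp(t)}\Big(\tfrac{\mu_\sharp}2|D(w_\sharp)|^2+\tfrac{\lambda_\sharp}2|\operatorname{div}w_\sharp|^2\Big)dx-\int_{\Gamma(t)}\Big(\tfrac{\mu_S}2|D_\Gamma(w_S)|^2+\tfrac{\lambda_S}2|\operatorname{div}_\Gamma w_S|^2\Big)d\mathcal H^2,$$ $$E_W[w_A,w_B,w_S]=\sum_{\sharp=A,B}\int_{\Omega_\sharp(t)}(\operatorname{div}w_\sharp)\pi_\sharp\,dx+\int_{\Gamma(t)}(\operatorname{div}_\Gamma w_S)\pi_S\,d\mathcal H^2,\qquad E_{D+W}=E_D+E_W.$$ *Statement.* Let $r\in\{0,1\}$, $0<t<T$, and let $\mathcal F_A,\mathcal F_B,\mathcal F_S:\mathbb R^3\to\mathbb R^3$ be continuous.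 Assume that for all $\varphi_A,\varphi_B,\varphi_S\in C^\infty(\mathbb R^3;\mathbb R^3)$ satisfying $$\varphi_B=0\ \text{on }\partial\Omega,\qquad \varphi_A\cdot n_\Gamma=\varphi_B\cdot n_\Gamma=\varphi_S\cdot n_\Gamma\ \text{ and }\ P_\Gamma\varphi_A=P_\Gamma\varphi_B=rP_\Gamma\varphi_S\ \text{ on }\Gamma(t)$$ one has (with $v_\sharp$ taken at time $t$) $$\frac{d}{d\varepsilon}\Big|_{\varepsilon=0}E_{D+W}[v_A+\varepsilon\varphi_A,v_B+\varepsilon\varphi_B,v_S+\varepsilon\varphi_S]=\int_{\Omega_A(t)}\mathcal F_A\cdot\varphi_A\,dx+\int_{\Omega_B(t)}\mathcal F_B\cdot\varphi_B\,dx+\int_{\Gamma(t)}\mathcal F_S\cdot\varphi_S\,d\mathcal H^2.$$ Then, at time $t$, $$\mathcal F_A=\operatorname{div}\mathcal T_A\ \text{ in }\Omega_A(t),\qquad \mathcal F_B=\operatorname{div}\mathcal T_B\ \text{ in }\Omega_B(t),\qquad \mathcal F_S=\operatorname{div}_\Gamma\mathcal T_S+\widetilde{\mathcal T}_Bn_\Gamma-\widetilde{\mathcal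 T}_An_\Gamma\ \text{ on }\Gamma(t).$$ -/

import Mathlib

open MeasureTheory Set Matrix
open scoped ContDiff Topology

namespace TwoPhase

noncomputable section

/-- Three dimensional Euclidean space. -/
abbrev E3 := EuclideanSpace ℝ (Fin 3)

/-! ### Domains with smooth boundary, outer normal, tangential calculus -/

/-- `g` is a smooth function with non-vanishing gradient at `p`, and near `p` the set `U` is the
set where `g` is negative. -/
def IsLocalDefiningFunction (U : Set E3) (p : E3) (g : E3 → ℝ) : Prop :=
  ContDiff ℝ ∞ g ∧ gradient g p ≠ 0 ∧ ∀ᶠ x in 𝓝 p, (x ∈ U ↔ g x < 0)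

/-- A bounded domain (nonempty, open, connected) of `ℝ³` whose boundary is a smooth surface, with
the domain locally on one side of it. The boundary is then a compact two dimensional smooth
submanifold without boundary. -/
structure IsSmoothBoundedDomain (U : Set E3) : Prop where
  isOpen : IsOpen U
  isConnected : IsConnected U
  isBounded : Bornology.IsBounded U
  smooth_boundary : ∀ p ∈ frontier U, ∃ g, IsLocalDefiningFunction U p g

open Classical in
/-- The outer unit normal of `U` at the boundary point `x`: the normalized gradient of a local
defining function (it does not depend on which one). -/
def outerNormal (U : Set E3) (x : E3) : E3 :=
  if h : ∃ g, IsLocalDefiningFunction U x g then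
    ‖gradient h.choose x‖⁻¹ • gradient h.choose x
  else 0

/-- The standard basis vector `e_j`. -/
def basisVec (j : Fin 3) : E3 := EuclideanSpace.single j (1 : ℝ)

/-- The partial derivative `∂_j f`. -/
def partialD (j : Fin 3) (f : E3 → ℝ) (x : E3) : ℝ := fderiv ℝ f x (basisVec j)

/-- The tangential derivative `∂^Γ_j f = ∂_j f - n_j (n · ∇) f` on the surface `Γ = frontier U` with
normal `n = outerNormal U`, i.e. the derivative of `f` along `Γ` in the tangential direction
`e_j - n_j n`. It only involves the values of `f` on `Γ`, so that it applies to functions that are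
meaningful on `Γ` only (such as those built from `n`): the derivative within `Γ` is unique in
tangential directions, and for `f` differentiable on `ℝ³` it is the derivative of `f`. -/
def surfaceD (U : Set E3) (j : Fin 3) (f : E3 → ℝ) (x : E3) : ℝ :=
  fderivWithin ℝ f (frontier U) x (basisVec j - outerNormal U x j • outerNormal U x)

/-- The orthogonal projection `P_Γ = I - n ⊗ n`. -/
def projTangent (U : Set E3) (x : E3) : Matrix (Fin 3) (Fin 3) ℝ :=
  fun i j => (1 : Matrix (Fin 3) (Fin 3) ℝ) i j - outerNormal U x i * outerNormal U x j

/-- The product of a matrix and a vector of `ℝ³`. -/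
def mulV (M : Matrix (Fin 3) (Fin 3) ℝ) (w : E3) : E3 := WithLp.toLp 2 (M *ᵥ w.ofLp)

/-- The Frobenius inner product `M : N`. -/
def frob (M N : Matrix (Fin 3) (Fin 3) ℝ) : ℝ := ∑ i, ∑ j, M i j * N i j

/-- `div v`. -/
def divV (v : E3 → E3) (x : E3) : ℝ := ∑ j, partialD j (fun y => v y j) x

/-- `div_Γ v`. -/
def surfDivV (U : Set E3) (v : E3 → E3) (x : E3) : ℝ := ∑ j, surfaceD U j (fun y => v y j) x

/-- The matrix `∇ v`, with entries `∂_j v_i`. -/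
def gradV (v : E3 → E3) (x : E3) : Matrix (Fin 3) (Fin 3) ℝ :=
  fun i j => partialD j (fun y => v y i) x

/-- The matrix `∇_Γ v`, with entries `∂^Γ_j v_i`. -/
def surfGradV (U : Set E3) (v : E3 → E3) (x : E3) : Matrix (Fin 3) (Fin 3) ℝ :=
  fun i j => surfaceD U j (fun y => v y i) x

/-- The divergence of a matrix field, row by row. -/
def divM (M : E3 → Matrix (Fin 3) (Fin 3) ℝ) (x : E3) : E3 :=
  WithLp.toLp 2 fun i => ∑ j, partialD j (fun y => M y i j) x

/-- The surface divergence of a matrix field, row by row. -/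
def surfDivM (U : Set E3) (M : E3 → Matrix (Fin 3) (Fin 3) ℝ) (x : E3) : E3 :=
  WithLp.toLp 2 fun i => ∑ j, surfaceD U j (fun y => M y i j) x

/-! ### Strain and stress tensors -/

/-- The strain rate tensor `D(v)`. -/
def strain (v : E3 → E3) (x : E3) : Matrix (Fin 3) (Fin 3) ℝ :=
  (1 / 2 : ℝ) • (gradV v x + (gradV v x)ᵀ)

/-- The surface strain tensor `D_Γ(v)`. -/
def surfStrain (U : Set E3) (v : E3 → E3) (x : E3) : Matrix (Fin 3) (Fin 3) ℝ :=
  (1 / 2 : ℝ) • (projTangent U x * surfGradV U v x + (projTangent U x * surfGradV U v x)ᵀ)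

/-- The bulk stress tensor `μ D(v) + λ (div v) I - π I`. -/
def stress (μ lam p : E3 → ℝ) (v : E3 → E3) (x : E3) : Matrix (Fin 3) (Fin 3) ℝ :=
  μ x • strain v x + (lam x * divV v x) • (1 : Matrix (Fin 3) (Fin 3) ℝ)
    - p x • (1 : Matrix (Fin 3) (Fin 3) ℝ)

/-- The Boussinesq-Scriven surface stress tensor `μ D_Γ(v) + λ (div_Γ v) P_Γ - π P_Γ`. -/
def surfStress (U : Set E3) (μ lam p : E3 → ℝ) (v : E3 → E3) (x : E3) :
    Matrix (Fin 3) (Fin 3) ℝ :=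
  μ x • surfStrain U v x + (lam x * surfDivV U v x) • projTangent U x - p x • projTangent U x

/-- `n_Γ · (n_Γ · ∇) v`. -/
def normalNormalD (U : Set E3) (v : E3 → E3) (x : E3) : ℝ :=
  ∑ i, outerNormal U x i * ∑ j, outerNormal U x j * partialD j (fun y => v y i) x

/-- The interface stress: for `r = 0` the scalar (multiple of the identity)
`μ n · (n · ∇) v + λ div v - π`, otherwise the bulk stress tensor. -/
def interfaceStress (r : ℝ) (U : Set E3) (μ lam p : E3 → ℝ) (v : E3 → E3) (x : E3) :
    Matrix (Fin 3) (Fin 3) ℝ :=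
  if r = 0 then
    (μ x * normalNormalD U v x + lam x * divV v x - p x) • (1 : Matrix (Fin 3) (Fin 3) ℝ)
  else stress μ lam p v x

/-! ### Energies. The measure `μHE[2]` is the two dimensional Hausdorff measure, normalized to be
the area on planes. -/

/-- Viscous dissipation energy in the domain `W`. -/
def bulkDissipation (W : Set E3) (μ lam : E3 → ℝ) (v : E3 → E3) : ℝ :=
  ∫ x in W, (-(μ x / 2) * frob (strain v x) (strain v x) - lam x / 2 * |divV v x| ^ 2)

/-- Viscous dissipation energy on the surface `frontier U`. -/
def surfDissipation (U : Set E3) (μ lam : E3 → ℝ) (v : E3 → E3) : ℝ :=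
  ∫ x in frontier U, (-(μ x / 2) * frob (surfStrain U v x) (surfStrain U v x)
    - lam x / 2 * |surfDivV U v x| ^ 2) ∂μHE[2]

/-- Work done by the pressure in the domain `W`. -/
def bulkWork (W : Set E3) (p : E3 → ℝ) (v : E3 → E3) : ℝ := ∫ x in W, divV v x * p x

/-- Work done by the pressure on the surface `frontier U`. -/
def surfWork (U : Set E3) (p : E3 → ℝ) (v : E3 → E3) : ℝ :=
  ∫ x in frontier U, surfDivV U v x * p x ∂μHE[2]

/-- `E_D[v_A, v_B, v_S]` for the domain `U`, the domain `W` outside, and the surface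
`frontier U`. -/
def energyD (U W : Set E3) (μA lamA μB lamB μS lamS : E3 → ℝ) (vA vB vS : E3 → E3) : ℝ :=
  bulkDissipation U μA lamA vA + bulkDissipation W μB lamB vB + surfDissipation U μS lamS vS

/-- `E_W[v_A, v_B, v_S]`. -/
def energyW (U W : Set E3) (pA pB pS : E3 → ℝ) (vA vB vS : E3 → E3) : ℝ :=
  bulkWork U pA vA + bulkWork W pB vB + surfWork U pS vS

/-- Admissible test triples: smooth fields, `φ_B` vanishing on `∂Ω`, with equal normal components
on the interface `Γ = frontier U` and tangential parts `P_Γ φ_A = P_Γ φ_B = r P_Γ φ_S` there. -/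
structure IsAdmissible (r : ℝ) (Ω U : Set E3) (φA φB φS : E3 → E3) : Prop where
  smoothA : ContDiff ℝ ∞ φA
  smoothB : ContDiff ℝ ∞ φB
  smoothS : ContDiff ℝ ∞ φS
  outer : ∀ x ∈ frontier Ω, φB x = 0
  normal_AB : ∀ x ∈ frontier U, inner ℝ (φA x) (outerNormal U x) = inner ℝ (φB x) (outerNormal U x)
  normal_BS : ∀ x ∈ frontier U, inner ℝ (φB x) (outerNormal U x) = inner ℝ (φS x) (outerNormal U x)
  tangent_AB : ∀ x ∈ frontier U, mulV (projTangent U x) (φA x) = mulV (projTangent U x) (φB x)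
  tangent_BS : ∀ x ∈ frontier U,
    mulV (projTangent U x) (φB x) = r • mulV (projTangent U x) (φS x)

end

end TwoPhase

open TwoPhase

namespace TwoPhase

open Module Topology
open scoped NNReal ENNReal

set_option linter.unusedSectionVars false

section

/-! ### The area formula for bi-Lipschitz `C¹` parametrizations -/

/-! The energy is a quadratic polynomial in ε, so its first variation is the linear coefficient.
Pointwise algebra turns it into minus the integrals of `T_A : ∇φ_A`, `T_B : ∇φ_B` and `T_S : ∇_Γ
φ_S` (`hasDerivAt_energy`). Uniqueness of derivatives makes this equal to the work of the forces for
all admissible triples, and what remains is integration by parts and localization.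

Test fields supported in one of the two bulk domains give the bulk equations
(`eq_divM_of_forall_setIntegral`). Once these are inserted, the volume terms cancel for fields
supported near a point of the interface. There remain the boundary terms of the two bulk stresses,
with opposite signs because the normal is shared, and the surface divergence of `T_S`
(`IsBoundaryChart.interface_balance`). To isolate component `i`, the surface field is `ψ e_i`. It is
paired in both bulk phases with `ψ e_i` if `r = 1`, and with its normal part `ψ n_i n` if `r = 0`.
The second choice sees only `n · T n`, which explains the scalar interface stress
(`interface_force_eq`).

The analytic input is a local divergence theorem on a smooth domain with respect to Hausdorff
measure. Near a boundary point the domain is a subgraph, by the implicit function theorem. A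
volume-preserving shear flattens it, where Fubini and the fundamental theorem of calculus apply
(`setIntegral_subgraph_fderiv`), and the area formula identifies the boundary integral
(`map_withDensity_normDet`). The result is packaged in `IsBoundaryChart`.

The surface divergence theorem is deduced from the bulk one: `∫ (N_i ∂_j f - N_j ∂_i f)` over the
surface is the bulk integral of `∂_i ∂_j f - ∂_j ∂_i f`, hence zero. Applied to `f = N_k Y_j` and
summed, this yields the theorem for tangential `Y`. The rows of `T_S` are tangential, so no
curvature term appears. -/

theorem measure_le_mul_of_forall_nhds {X : Type*} [TopologicalSpace X] [SecondCountableTopology X]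
    [MeasurableSpace X] [OpensMeasurableSpace X] {μ ν : Measure X} {c : ℝ≥0∞}
    (h : ∀ x, ∃ W ∈ 𝓝 x, ∀ A ⊆ W, MeasurableSet A → μ A ≤ c * ν A) {A : Set X}
    (hA : MeasurableSet A) : μ A ≤ c * ν A := by
  rcases isEmpty_or_nonempty X with hX | hX
  · simp [Set.eq_empty_of_isEmpty A]
  choose W hW hle using h
  obtain ⟨s, hs, hsu⟩ := TopologicalSpace.countable_cover_nhds
    (fun x => interior_mem_nhds.2 (hW x))
  have hsne : s.Nonempty := by
    rw [nonempty_iff_ne_empty]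
    rintro rfl
    simp at hsu
    exact empty_ne_univ hsu
  obtain ⟨u, rfl⟩ := hs.exists_eq_range hsne
  set V : ℕ → Set X := fun n => interior (W (u n)) with hV
  have hVu : ⋃ n, V n = univ := by simpa [hV] using hsu
  have hm : ∀ n, MeasurableSet (A ∩ disjointed V n) := fun n =>
    hA.inter (MeasurableSet.disjointed (fun n => isOpen_interior.measurableSet) n)
  have hd : Pairwise (Function.onFun Disjoint fun n => A ∩ disjointed V n) := fun i j hij =>
    (disjoint_disjointed V hij).mono inter_subset_right inter_subset_right
  have hAu : A = ⋃ n, A ∩ disjointed V n := by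
    rw [← inter_iUnion, iUnion_disjointed, hVu, inter_univ]
  calc μ A = ∑' n, μ (A ∩ disjointed V n) := by
        conv_lhs => rw [hAu]
        exact measure_iUnion hd hm
    _ ≤ ∑' n, c * ν (A ∩ disjointed V n) := by
        refine ENNReal.tsum_le_tsum fun n => hle (u n) _ ?_ (hm n)
        exact inter_subset_right.trans ((disjointed_subset V n).trans interior_subset)
    _ = c * ν A := by
        rw [ENNReal.tsum_mul_left, ← measure_iUnion hd hm, ← hAu]

/-- The assumption makes `g a ↦ f a` a well-defined `K`-Lipschitz map from `g '' A` onto `f '' A`,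
and Lipschitz maps scale `d`-dimensional Hausdorff measure by at most `K ^ d`. -/
theorem euclideanHausdorffMeasure_image_le_of_dist_le {X Y Z : Type*} [MeasurableSpace X]
    [MetricSpace Y] [MeasurableSpace Y] [BorelSpace Y] [MetricSpace Z] [MeasurableSpace Z]
    [BorelSpace Z] {d : ℕ} {K : ℝ≥0} {A : Set X} {f : X → Y} {g : X → Z}
    (h : ∀ a ∈ A, ∀ b ∈ A, dist (f a) (f b) ≤ K * dist (g a) (g b)) :
    μHE[d] (f '' A) ≤ (K : ℝ≥0∞) ^ d * μHE[d] (g '' A) := by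
  rcases isEmpty_or_nonempty X with hX | hX
  · simp [Set.eq_empty_of_isEmpty A]
  set k := f ∘ Function.invFunOn g A
  have hk : LipschitzOnWith K k (g '' A) := by
    refine LipschitzOnWith.of_dist_le_mul ?_
    intro x hx y hy
    have h1 := h _ (Function.invFunOn_mem hx) _ (Function.invFunOn_mem hy)
    rwa [Function.invFunOn_eq hx, Function.invFunOn_eq hy] at h1
  have himg : k '' (g '' A) = f '' A := by
    rw [image_image]
    refine image_congr fun a ha => ?_
    have hga : g a ∈ g '' A := mem_image_of_mem g ha
    have h1 := h _ (Function.invFunOn_mem hga) a ha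
    rw [Function.invFunOn_eq hga, dist_self, mul_zero] at h1
    exact dist_le_zero.1 h1
  have h2 := hk.hausdorffMeasure_image_le (d := d) (Nat.cast_nonneg d)
  rw [himg, ENNReal.rpow_natCast] at h2
  rw [Measure.euclideanHausdorffMeasure_def, Measure.euclideanHausdorffMeasure_def]
  simp only [Measure.smul_apply, Measure.nnreal_smul_coe_apply]
  rw [mul_left_comm]
  gcongr

variable {F E : Type*} [NormedAddCommGroup F] [InnerProductSpace ℝ F] [FiniteDimensional ℝ F]
  [MeasurableSpace F] [BorelSpace F] [NormedAddCommGroup E] [InnerProductSpace ℝ E]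
  [FiniteDimensional ℝ E] [MeasurableSpace E] [BorelSpace E]

theorem norm_le_norm_fderiv_of_norm_sub_le {φ : F → E} (hφ : ContDiff ℝ 1 φ)
    (hanti : ∀ y y', ‖y - y'‖ ≤ ‖φ y - φ y'‖) (y v : F) : ‖v‖ ≤ ‖fderiv ℝ φ y v‖ := by
  have h1 : HasDerivAt (fun s : ℝ => φ (y + s • v)) (fderiv ℝ φ y v) 0 := by
    have := (hφ.differentiable one_ne_zero y).hasFDerivAt.hasLineDerivAt v
    exact this
  have h2 := h1.tendsto_slope_zero.norm
  refine ge_of_tendsto h2 ?_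
  filter_upwards [self_mem_nhdsWithin] with s hs
  have := hanti (y + s • v) y
  have hs' : (s : ℝ) ≠ 0 := hs
  simp only [zero_add, zero_smul, add_zero, norm_smul, norm_inv, add_sub_cancel_left] at this ⊢
  rw [inv_mul_eq_div, le_div_iff₀ (norm_pos_iff.2 hs'), mul_comm]
  exact this

/-- Near `y₀` the map distorts distances, relative to its derivative there, by a factor at most `c`
in either direction. This costs `c ^ d` in measure. Replacing the density by its value at `y₀` costs
one more factor `c`, and for the linear map the formula is exact. -/
theorem exists_nhds_measure_image_comparison {φ : F → E} (hφ : ContDiff ℝ 1 φ)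
    (hanti : ∀ y y', ‖y - y'‖ ≤ ‖φ y - φ y'‖)
    (hJ : Continuous fun y => LinearMap.normDet (fderiv ℝ φ y : F →ₗ[ℝ] E))
    {c : ℝ≥0} (hc : 1 < c) (y₀ : F) :
    ∃ W ∈ 𝓝 y₀, ∀ A ⊆ W, MeasurableSet A →
      μHE[finrank ℝ F] (φ '' A) ≤ (c : ℝ≥0∞) ^ (finrank ℝ F + 1) *
        ∫⁻ y in A, ENNReal.ofReal (LinearMap.normDet (fderiv ℝ φ y : F →ₗ[ℝ] E)) ∧
      ∫⁻ y in A, ENNReal.ofReal (LinearMap.normDet (fderiv ℝ φ y : F →ₗ[ℝ] E)) ≤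
        (c : ℝ≥0∞) ^ (finrank ℝ F + 1) * μHE[finrank ℝ F] (φ '' A) := by
  set L := fderiv ℝ φ y₀ with hL
  set J : F → ℝ := fun y => LinearMap.normDet (fderiv ℝ φ y : F →ₗ[ℝ] E) with hJd
  have hc0 : (0 : ℝ) < c := by exact_mod_cast zero_lt_one.trans hc
  have hc1 : (1 : ℝ) < c := by exact_mod_cast hc
  have hLn := norm_le_norm_fderiv_of_norm_sub_le hφ hanti y₀
  have hJ0 : 0 < J y₀ := by
    refine lt_of_le_of_ne (LinearMap.normDet_nonneg _) (Ne.symm ?_)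
    have hinj : Function.Injective (L : F →ₗ[ℝ] E) := by
      rw [injective_iff_map_eq_zero]
      intro v hv
      have := hLn v
      rw [show fderiv ℝ φ y₀ v = 0 from hv, norm_zero] at this
      exact norm_le_zero_iff.1 this
    exact ((LinearMap.normDet_ne_zero_tfae (L : F →ₗ[ℝ] E)).out 0 4).2 hinj
  -- With the error `1 - c⁻¹` the lower distortion bound is exactly `c⁻¹`, and the upper one is `2 -
  -- c⁻¹ ≤ c`.
  have hδ : (0 : ℝ) < 1 - (c : ℝ)⁻¹ := sub_pos.2 (inv_lt_one_of_one_lt₀ hc1)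
  have happ := ((hφ.contDiffAt (x := y₀)).hasStrictFDerivAt one_ne_zero).isLittleO.def hδ
  obtain ⟨W, hW, hWapp⟩ : ∃ W ∈ 𝓝 y₀, ∀ a ∈ W, ∀ b ∈ W,
      ‖φ a - φ b - L (a - b)‖ ≤ (1 - (c : ℝ)⁻¹) * ‖a - b‖ := by
    rw [nhds_prod_eq] at happ
    obtain ⟨W, hW, h⟩ := Filter.eventually_prod_self_iff'.1 happ
    exact ⟨W, hW, fun a ha b hb => h a ha b hb⟩
  have hJ1 : ∀ᶠ y in 𝓝 y₀, J y < c * J y₀ :=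
    (hJ.tendsto y₀).eventually_lt_const (by nlinarith)
  have hJ2 : ∀ᶠ y in 𝓝 y₀, (c : ℝ)⁻¹ * J y₀ < J y :=
    (hJ.tendsto y₀).eventually_const_lt (by nlinarith)
  refine ⟨W ∩ {y | J y < c * J y₀ ∧ (c : ℝ)⁻¹ * J y₀ < J y},
    Filter.inter_mem hW (hJ1.and hJ2), fun A hA hAm => ?_⟩
  have hlin : μHE[finrank ℝ F] (L '' A) = ENNReal.ofReal (J y₀) * volume A :=
    LinearMap.euclideanHausdorffMeasure_image_eq_normDet_mul_volume (L : F →ₗ[ℝ] E) A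
  have hup : ∀ a ∈ A, ∀ b ∈ A, dist (φ a) (φ b) ≤ c * dist (L a) (L b) := by
    intro a ha b hb
    rw [dist_eq_norm, dist_eq_norm, ← map_sub]
    have h1 := hWapp a (hA ha).1 b (hA hb).1
    have h2 : ‖a - b‖ ≤ ‖L (a - b)‖ := hLn (a - b)
    have h3 := norm_sub_norm_le (φ a - φ b) (L (a - b))
    have h4 : 1 + (1 - (c : ℝ)⁻¹) ≤ c := by
      have : (c : ℝ) * (c : ℝ)⁻¹ = 1 := mul_inv_cancel₀ hc0.ne'
      nlinarith
    have h5 := mul_le_mul_of_nonneg_left h2 hδ.le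
    have h6 := mul_le_mul_of_nonneg_right h4 (norm_nonneg (L (a - b)))
    linarith
  have hdown : ∀ a ∈ A, ∀ b ∈ A, dist (L a) (L b) ≤ c * dist (φ a) (φ b) := by
    intro a ha b hb
    rw [dist_eq_norm, dist_eq_norm, ← map_sub]
    have h1 := hWapp a (hA ha).1 b (hA hb).1
    have h2 : ‖a - b‖ ≤ ‖L (a - b)‖ := hLn (a - b)
    have h3 := norm_sub_norm_le (L (a - b)) (φ a - φ b)
    rw [norm_sub_rev (L (a - b))] at h3
    have h5 := mul_le_mul_of_nonneg_left h2 hδ.le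
    have h6 : (c : ℝ)⁻¹ * ‖L (a - b)‖ ≤ ‖φ a - φ b‖ := by linarith
    rwa [inv_mul_le_iff₀ hc0] at h6
  have hcJ : ENNReal.ofReal (c * J y₀) = c * ENNReal.ofReal (J y₀) := by
    rw [ENNReal.ofReal_mul hc0.le, ENNReal.ofReal_coe_nnreal]
  constructor
  · calc μHE[finrank ℝ F] (φ '' A)
        ≤ (c : ℝ≥0∞) ^ finrank ℝ F * (ENNReal.ofReal (J y₀) * volume A) :=
          hlin ▸ euclideanHausdorffMeasure_image_le_of_dist_le hup
      _ ≤ (c : ℝ≥0∞) ^ finrank ℝ F * (c * ∫⁻ y in A, ENNReal.ofReal (J y)) := by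
          refine mul_le_mul_right ?_ _
          rw [← lintegral_const_mul' _ _ ENNReal.coe_ne_top, ← setLIntegral_const]
          refine setLIntegral_mono' hAm fun y hy => ?_
          have := (hA hy).2.2
          rw [inv_mul_lt_iff₀ hc0] at this
          rw [← ENNReal.ofReal_coe_nnreal, ← ENNReal.ofReal_mul hc0.le]
          exact ENNReal.ofReal_le_ofReal this.le
      _ = _ := by rw [pow_succ, mul_assoc]
  · calc ∫⁻ y in A, ENNReal.ofReal (J y)
        ≤ c * (ENNReal.ofReal (J y₀) * volume A) := by
          rw [← mul_assoc, ← hcJ, ← setLIntegral_const]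
          exact setLIntegral_mono' hAm fun y hy => ENNReal.ofReal_le_ofReal (hA hy).2.1.le
      _ ≤ c * ((c : ℝ≥0∞) ^ finrank ℝ F * μHE[finrank ℝ F] (φ '' A)) := by
          rw [← hlin]
          gcongr
          exact euclideanHausdorffMeasure_image_le_of_dist_le hdown
      _ = _ := by rw [pow_succ']; ring

/-- Let `c` decrease to `1`. Infinite `b` causes no trouble because the limiting factor `1` is
nonzero. -/
theorem le_of_forall_le_pow_mul {a b : ℝ≥0∞} {n : ℕ}
    (h : ∀ c : ℝ≥0, 1 < c → a ≤ (c : ℝ≥0∞) ^ n * b) : a ≤ b := by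
  have h1 : Filter.Tendsto (fun c : ℝ≥0 => (c : ℝ≥0∞) ^ n * b) (𝓝[>] 1) (𝓝 (1 * b)) := by
    refine ENNReal.Tendsto.mul_const ?_ (Or.inl one_ne_zero)
    have : Filter.Tendsto (fun c : ℝ≥0 => ((c ^ n : ℝ≥0) : ℝ≥0∞)) (𝓝 1) (𝓝 ((1 ^ n : ℝ≥0) : ℝ≥0∞)) :=
      ENNReal.tendsto_coe.2 ((continuous_pow n).tendsto 1)
    simpa using this.mono_left nhdsWithin_le_nhds
  rw [one_mul] at h1
  have : (𝓝[>] (1 : ℝ≥0)).NeBot := nhdsGT_neBot_of_exists_gt ⟨2, one_lt_two⟩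
  exact ge_of_tendsto h1 (by filter_upwards [self_mem_nhdsWithin] with c hc using h c hc)

theorem measurableEmbedding_of_norm_sub_le {φ : F → E} (hφ : Continuous φ)
    (hanti : ∀ y y', ‖y - y'‖ ≤ ‖φ y - φ y'‖) : MeasurableEmbedding φ := by
  refine hφ.measurableEmbedding fun y y' h => ?_
  have := hanti y y'
  rw [h, sub_self, norm_zero] at this
  exact sub_eq_zero.1 (norm_le_zero_iff.1 this)

/-- The area formula. -/
theorem map_withDensity_normDet {φ : F → E} (hφ : ContDiff ℝ 1 φ)
    (hanti : ∀ y y', ‖y - y'‖ ≤ ‖φ y - φ y'‖)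
    (hJ : Continuous fun y => LinearMap.normDet (fderiv ℝ φ y : F →ₗ[ℝ] E)) :
    ((volume : Measure F).withDensity
        fun y => ENNReal.ofReal (LinearMap.normDet (fderiv ℝ φ y : F →ₗ[ℝ] E))).map φ =
      (μHE[finrank ℝ F]).restrict (range φ) := by
  have hemb := measurableEmbedding_of_norm_sub_le hφ.continuous hanti
  -- The Hausdorff measure pulled back to `F` and the measure with density are each at most `c ^ (d
  -- + 1)` times the other locally, hence globally, for every `c > 1`.
  have key : (μHE[finrank ℝ F] : Measure E).comap φ = (volume : Measure F).withDensity
      fun y => ENNReal.ofReal (LinearMap.normDet (fderiv ℝ φ y : F →ₗ[ℝ] E)) := by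
    ext A hA
    refine le_antisymm (le_of_forall_le_pow_mul (n := finrank ℝ F + 1) fun c hc => measure_le_mul_of_forall_nhds ?_ hA)
      (le_of_forall_le_pow_mul (n := finrank ℝ F + 1) fun c hc => measure_le_mul_of_forall_nhds ?_ hA)
    all_goals
      intro y₀
      obtain ⟨W, hW, h⟩ := exists_nhds_measure_image_comparison hφ hanti hJ hc y₀
      refine ⟨W, hW, fun B hB hBm => ?_⟩
      rw [hemb.comap_apply, withDensity_apply _ hBm]
    exacts [(h B hB hBm).1, (h B hB hBm).2]
  rw [← key, hemb.map_comap]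

end

section

variable {F E : Type*} [NormedAddCommGroup F] [InnerProductSpace ℝ F] [FiniteDimensional ℝ F]
  [NormedAddCommGroup E] [InnerProductSpace ℝ E] [FiniteDimensional ℝ E]

/-! ### Graphs over a hyperplane -/

/-- `ι` embeds `F` isometrically as the hyperplane orthogonal to the unit vector `e`. -/
structure IsFrame (ι : F →ₗᵢ[ℝ] E) (e : E) : Prop where
  norm_eq_one : ‖e‖ = 1
  inner_eq_zero : ∀ y, inner ℝ (ι y) e = 0
  finrank_eq : finrank ℝ E = finrank ℝ F + 1

theorem IsFrame.norm_sq {ι : F →ₗᵢ[ℝ] E} {e : E} (hf : IsFrame ι e) (y : F) (s : ℝ) :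
    ‖ι y + s • e‖ ^ 2 = ‖y‖ ^ 2 + s ^ 2 := by
  rw [norm_add_sq_real, inner_smul_right, hf.inner_eq_zero, norm_smul, hf.norm_eq_one, ι.norm_map]
  simp

/-- The orthogonal coordinates attached to a frame. -/
noncomputable def frameEquiv {ι : F →ₗᵢ[ℝ] E} {e : E} (hf : IsFrame ι e) : (F × ℝ) ≃L[ℝ] E :=
  (LinearEquiv.ofInjectiveOfFinrankEq
    (ι.toLinearMap.coprod (LinearMap.toSpanSingleton ℝ E e)) (by
      rw [injective_iff_map_eq_zero]
      rintro ⟨y, s⟩ h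
      have h1 := hf.norm_sq y s
      have h2 : ι y + s • e = 0 := h
      rw [h2, norm_zero] at h1
      have h3 : ‖y‖ ^ 2 = 0 := by nlinarith [sq_nonneg ‖y‖, sq_nonneg s]
      have h4 : s ^ 2 = 0 := by nlinarith [sq_nonneg ‖y‖, sq_nonneg s]
      simp_all)
    (by simp [hf.finrank_eq])).toContinuousLinearEquiv

theorem frameEquiv_apply {ι : F →ₗᵢ[ℝ] E} {e : E} (hf : IsFrame ι e) (p : F × ℝ) :
    frameEquiv hf p = ι p.1 + p.2 • e := rfl

theorem frameEquiv_inner {ι : F →ₗᵢ[ℝ] E} {e : E} (hf : IsFrame ι e) (p q : F × ℝ) :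
    inner ℝ (frameEquiv hf p) (frameEquiv hf q) = inner ℝ p.1 q.1 + p.2 * q.2 := by
  simp only [frameEquiv_apply, inner_add_left, inner_add_right, inner_smul_left, inner_smul_right,
    hf.inner_eq_zero, real_inner_comm _ e, ι.inner_map_map, real_inner_self_eq_norm_sq,
    hf.norm_eq_one]
  simp
  ring

/-- The coordinates in which the graph of `h` is the hyperplane `s = 0`. -/
noncomputable def graphHomeomorph {ι : F →ₗᵢ[ℝ] E} {e : E} (hf : IsFrame ι e) {h : F → ℝ}
    (hh : Continuous h) : F × ℝ ≃ₜ E :=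
  Homeomorph.trans
    { toFun := fun p => (p.1, h p.1 + p.2)
      invFun := fun p => (p.1, p.2 - h p.1)
      left_inv := fun p => by simp
      right_inv := fun p => by simp
      continuous_toFun := by fun_prop
      continuous_invFun := by fun_prop } (frameEquiv hf).toHomeomorph

theorem graphHomeomorph_apply {ι : F →ₗᵢ[ℝ] E} {e : E} (hf : IsFrame ι e) {h : F → ℝ}
    (hh : Continuous h) (p : F × ℝ) :
    graphHomeomorph hf hh p = frameEquiv hf (p.1, h p.1 + p.2) := rfl

/-- The parametrization of the graph of `h`. -/
noncomputable def graphMap (ι : F →ₗᵢ[ℝ] E) (e : E) (h : F → ℝ) (y : F) : E := ι y + h y • e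

/-- The area density of the graph of `h`. -/
noncomputable def graphDensity (h : F → ℝ) (y : F) : ℝ := √(1 + ‖gradient h y‖ ^ 2)

/-- The upward unit normal of the graph of `h`. -/
noncomputable def graphNormal (ι : F →ₗᵢ[ℝ] E) (e : E) (h : F → ℝ) (y : F) : E :=
  (graphDensity h y)⁻¹ • (e - ι (gradient h y))

theorem graphDensity_pos (h : F → ℝ) (y : F) : 0 < graphDensity h y :=
  Real.sqrt_pos.2 (by positivity)

theorem continuous_gradient {h : F → ℝ} (hh : ContDiff ℝ 1 h) : Continuous (gradient h) :=
  (InnerProductSpace.toDual ℝ F).symm.continuous.comp (hh.continuous_fderiv one_ne_zero)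

theorem continuous_graphDensity {h : F → ℝ} (hh : ContDiff ℝ 1 h) :
    Continuous (graphDensity h) := by
  have := continuous_gradient hh
  unfold graphDensity
  fun_prop

theorem inner_gradient {h : F → ℝ} (y v : F) : inner ℝ (gradient h y) v = fderiv ℝ h y v := by
  rw [gradient, InnerProductSpace.toDual_symm_apply]

theorem contDiff_graphMap (ι : F →ₗᵢ[ℝ] E) (e : E) {h : F → ℝ} (hh : ContDiff ℝ 1 h) :
    ContDiff ℝ 1 (graphMap ι e h) :=
  ι.toContinuousLinearMap.contDiff.add (hh.smul contDiff_const)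

theorem hasFDerivAt_graphMap (ι : F →ₗᵢ[ℝ] E) (e : E) {h : F → ℝ} (hh : ContDiff ℝ 1 h) (y : F) :
    HasFDerivAt (graphMap ι e h)
      (ι.toContinuousLinearMap + (fderiv ℝ h y).smulRight e) y :=
  ι.toContinuousLinearMap.hasFDerivAt.add
    ((hh.differentiable one_ne_zero y).hasFDerivAt.smul_const e)

theorem graphMap_eq {ι : F →ₗᵢ[ℝ] E} {e : E} (hf : IsFrame ι e) {h : F → ℝ} (y : F) :
    graphMap ι e h y = frameEquiv hf (y, h y) := rfl

theorem norm_sub_le_graphMap {ι : F →ₗᵢ[ℝ] E} {e : E} (hf : IsFrame ι e) {h : F → ℝ} (y y' : F) :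
    ‖y - y'‖ ≤ ‖graphMap ι e h y - graphMap ι e h y'‖ := by
  have h1 : graphMap ι e h y - graphMap ι e h y' = ι (y - y') + (h y - h y') • e := by
    simp only [graphMap, map_sub, sub_smul]
    abel
  rw [h1, ← abs_of_nonneg (norm_nonneg (y - y')),
    ← abs_of_nonneg (norm_nonneg (ι (y - y') + (h y - h y') • e)), ← sq_le_sq, hf.norm_sq]
  nlinarith [sq_nonneg (h y - h y')]

/-- In an orthonormal basis the Gram matrix of the derivative is the identity plus the rank-one
matrix `u uᵀ`, where `u` lists the partial derivatives of `h`. Its determinant is `1 + |u|²`. -/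
theorem normDet_fderiv_graphMap {ι : F →ₗᵢ[ℝ] E} {e : E} (hf : IsFrame ι e) {h : F → ℝ}
    (hh : ContDiff ℝ 1 h) (y : F) :
    LinearMap.normDet (fderiv ℝ (graphMap ι e h) y : F →ₗ[ℝ] E) = graphDensity h y := by
  rw [graphDensity, eq_comm, Real.sqrt_eq_iff_eq_sq (by positivity) (LinearMap.normDet_nonneg _)]
  set b := stdOrthonormalBasis ℝ F
  have h1 := LinearMap.normDet_sq_eq_det_gram (fderiv ℝ (graphMap ι e h) y : F →ₗ[ℝ] E) b
  simp only [RCLike.ofReal_real_eq_id, id] at h1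
  rw [h1]
  set u : Fin (finrank ℝ F) → ℝ := fun i => fderiv ℝ h y (b i) with hu
  have h2 : Matrix.gram ℝ (fun i => (fderiv ℝ (graphMap ι e h) y : F →ₗ[ℝ] E) (b i)) =
      1 + Matrix.replicateCol Unit u * Matrix.replicateRow Unit u := by
    ext i j
    rw [Matrix.gram_apply, (hasFDerivAt_graphMap ι e hh y).fderiv]
    have := frameEquiv_inner hf (b i, u i) (b j, u j)
    simp only [frameEquiv_apply] at this
    have hb := orthonormal_iff_ite.1 b.orthonormal i j
    simp only [ContinuousLinearMap.coe_coe, _root_.add_apply,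
      ContinuousLinearMap.smulRight_apply, LinearIsometry.coe_toContinuousLinearMap]
    rw [this, hb, Matrix.add_apply, Matrix.one_apply]
    simp [Matrix.mul_apply]
  rw [h2, Matrix.det_one_add_replicateCol_mul_replicateRow]
  have h3 : ‖gradient h y‖ ^ 2 = ∑ i, u i * u i := by
    rw [← b.sum_sq_norm_inner_right]
    refine Finset.sum_congr rfl fun i _ => ?_
    rw [real_inner_comm, inner_gradient, Real.norm_eq_abs, sq_abs, sq]
  rw [h3]
  simp [dotProduct]

theorem range_graphMap {ι : F →ₗᵢ[ℝ] E} {e : E} (hf : IsFrame ι e) {h : F → ℝ} :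
    range (graphMap ι e h) = {x | ((frameEquiv hf).symm x).2 = h ((frameEquiv hf).symm x).1} := by
  ext x
  constructor
  · rintro ⟨y, rfl⟩
    simp [graphMap_eq hf]
  · intro hx
    refine ⟨((frameEquiv hf).symm x).1, ?_⟩
    rw [graphMap_eq hf, ← (show _ = _ from hx)]
    simp

/-! ### Volume and surface measure in graph coordinates -/

variable [MeasurableSpace F] [BorelSpace F] [MeasurableSpace E] [BorelSpace E]

theorem measurePreserving_frameEquiv {ι : F →ₗᵢ[ℝ] E} {e : E} (hf : IsFrame ι e) :
    MeasurePreserving (frameEquiv hf) := by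
  -- The product carries the sup norm, so the coordinates are an isometry only after passing to the
  -- `L²` product, which has the same volume.
  let T : WithLp 2 (F × ℝ) ≃ₗᵢ[ℝ] E :=
    { toLinearEquiv := (WithLp.linearEquiv 2 ℝ (F × ℝ)).trans (frameEquiv hf).toLinearEquiv
      norm_map' := by
        intro x
        have h1 : ‖ι x.ofLp.1 + x.ofLp.2 • e‖ ^ 2 = ‖x‖ ^ 2 := by
          rw [hf.norm_sq, WithLp.prod_norm_sq_eq_of_L2]
          simp
        exact (sq_eq_sq₀ (norm_nonneg _) (norm_nonneg _)).1 h1 }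
  exact T.measurePreserving.comp (WithLp.volume_preserving_toLp F ℝ)

/-- On each vertical line the shear is a translation, so it preserves volume by Fubini, for merely
continuous `h`. -/
theorem measurePreserving_graphHomeomorph {ι : F →ₗᵢ[ℝ] E} {e : E} (hf : IsFrame ι e) {h : F → ℝ}
    (hh : Continuous h) : MeasurePreserving (graphHomeomorph hf hh) := by
  refine (measurePreserving_frameEquiv hf).comp (g := frameEquiv hf)
    (f := fun p : F × ℝ => (p.1, h p.1 + p.2)) ?_
  exact (MeasurePreserving.id (volume : Measure F)).skew_product (g := fun y s => h y + s)
    (by fun_prop) (Filter.Eventually.of_forall fun y => (measurePreserving_add_left volume (h y)).map_eq)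

theorem map_withDensity_graphDensity {ι : F →ₗᵢ[ℝ] E} {e : E} (hf : IsFrame ι e) {h : F → ℝ}
    (hh : ContDiff ℝ 1 h) :
    ((volume : Measure F).withDensity fun y => ENNReal.ofReal (graphDensity h y)).map
      (graphMap ι e h) = (μHE[finrank ℝ F]).restrict (range (graphMap ι e h)) := by
  have h1 := map_withDensity_normDet (contDiff_graphMap ι e hh) (norm_sub_le_graphMap hf)
    (by simp_rw [normDet_fderiv_graphMap hf hh]; exact continuous_graphDensity hh)
  simpa only [normDet_fderiv_graphMap hf hh] using h1

theorem measurableEmbedding_graphMap {ι : F →ₗᵢ[ℝ] E} {e : E} (hf : IsFrame ι e) {h : F → ℝ}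
    (hh : ContDiff ℝ 1 h) : MeasurableEmbedding (graphMap ι e h) :=
  measurableEmbedding_of_norm_sub_le (contDiff_graphMap ι e hh).continuous (norm_sub_le_graphMap hf)

theorem setIntegral_range_graphMap {ι : F →ₗᵢ[ℝ] E} {e : E} (hf : IsFrame ι e) {h : F → ℝ}
    (hh : ContDiff ℝ 1 h) (k : E → ℝ) :
    ∫ x in range (graphMap ι e h), k x ∂μHE[finrank ℝ F] =
      ∫ y, graphDensity h y * k (graphMap ι e h y) := by
  rw [← map_withDensity_graphDensity hf hh, (measurableEmbedding_graphMap hf hh).integral_map,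
    integral_withDensity_eq_integral_toReal_smul]
  · simp only [ENNReal.toReal_ofReal (graphDensity_pos h _).le, smul_eq_mul]
  · exact (continuous_graphDensity hh).measurable.ennreal_ofReal
  · simp

theorem euclideanHausdorffMeasure_range_graphMap_inter {ι : F →ₗᵢ[ℝ] E} {e : E} (hf : IsFrame ι e)
    {h : F → ℝ} (hh : ContDiff ℝ 1 h) {K : Set E} (hK : MeasurableSet K) :
    μHE[finrank ℝ F] (K ∩ range (graphMap ι e h)) =
      ∫⁻ y in graphMap ι e h ⁻¹' K, ENNReal.ofReal (graphDensity h y) := by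
  rw [← Measure.restrict_apply hK, ← map_withDensity_graphDensity hf hh,
    (measurableEmbedding_graphMap hf hh).map_apply, withDensity_apply]
  exact (measurableEmbedding_graphMap hf hh).measurable hK

/-- The parametrization does not decrease distances, so the preimage of a compact set is bounded and
closed, and the continuous density is integrable on it. -/
theorem euclideanHausdorffMeasure_range_graphMap_inter_lt_top {ι : F →ₗᵢ[ℝ] E} {e : E}
    (hf : IsFrame ι e) {h : F → ℝ} (hh : ContDiff ℝ 1 h) {K : Set E} (hK : IsCompact K) :
    μHE[finrank ℝ F] (K ∩ range (graphMap ι e h)) < ⊤ := by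
  rw [euclideanHausdorffMeasure_range_graphMap_inter hf hh hK.measurableSet]
  have hcpt : IsCompact (graphMap ι e h ⁻¹' K) := by
    refine Metric.isCompact_of_isClosed_isBounded
      (hK.isClosed.preimage (contDiff_graphMap ι e hh).continuous) ?_
    obtain ⟨C, hC⟩ := Metric.isBounded_iff.1 hK.isBounded
    refine Metric.isBounded_iff.2 ⟨C, fun a ha b hb => ?_⟩
    refine le_trans ?_ (hC ha hb)
    rw [dist_eq_norm, dist_eq_norm]
    exact norm_sub_le_graphMap hf a b
  have := ((continuous_graphDensity hh).locallyIntegrable (μ := volume)).integrableOn_isCompact hcpt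
  exact this.lintegral_lt_top

theorem euclideanHausdorffMeasure_range_graphMap_inter_pos {ι : F →ₗᵢ[ℝ] E} {e : E}
    (hf : IsFrame ι e) {h : F → ℝ} (hh : ContDiff ℝ 1 h) {V : Set E} (hV : IsOpen V)
    {y : F} (hy : graphMap ι e h y ∈ V) :
    0 < μHE[finrank ℝ F] (V ∩ range (graphMap ι e h)) := by
  rw [euclideanHausdorffMeasure_range_graphMap_inter hf hh hV.measurableSet]
  rw [setLIntegral_pos_iff (continuous_graphDensity hh).measurable.ennreal_ofReal]
  have : (Function.support fun y => ENNReal.ofReal (graphDensity h y)) = univ := by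
    ext y
    simp [graphDensity_pos h y]
  rw [this, univ_inter]
  exact (hV.preimage (contDiff_graphMap ι e hh).continuous).measure_pos _ ⟨y, hy⟩

theorem volume_range_graphMap {ι : F →ₗᵢ[ℝ] E} {e : E} (hf : IsFrame ι e) {h : F → ℝ}
    (hh : Continuous h) : volume (range (graphMap ι e h)) = 0 := by
  have h1 : range (graphMap ι e h) = graphHomeomorph hf hh '' (univ ×ˢ {0}) := by
    ext x
    simp only [mem_range, mem_image, mem_prod, mem_univ, true_and, mem_singleton_iff, Prod.exists]
    constructor
    · rintro ⟨y, rfl⟩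
      exact ⟨y, 0, rfl, by simp [graphHomeomorph_apply, graphMap_eq hf]⟩
    · rintro ⟨y, s, rfl, rfl⟩
      exact ⟨y, by simp [graphHomeomorph_apply, graphMap_eq hf]⟩
  rw [h1, ← (measurePreserving_graphHomeomorph hf hh).measure_preimage_emb
    (graphHomeomorph hf hh).measurableEmbedding,
    preimage_image_eq _ (graphHomeomorph hf hh).injective]
  rw [Measure.volume_eq_prod, Measure.prod_prod]
  simp

/-! ### The divergence theorem for subgraphs -/

theorem isClosedEmbedding_prodMk_const {X Y : Type*} [TopologicalSpace X] [TopologicalSpace Y]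
    [T1Space Y] (y : Y) : IsClosedEmbedding fun x : X => (x, y) := by
  refine ⟨isEmbedding_prodMkLeft y, ?_⟩
  have : range (fun x : X => (x, y)) = univ ×ˢ {y} := by
    ext ⟨a, b⟩
    simp [eq_comm]
  rw [this]
  exact isClosed_univ.prod isClosed_singleton

theorem isClosedEmbedding_const_prodMk {X Y : Type*} [TopologicalSpace X] [TopologicalSpace Y]
    [T1Space X] (x : X) : IsClosedEmbedding fun y : Y => (x, y) := by
  refine ⟨isEmbedding_prodMkRight x, ?_⟩
  have : range (fun y : Y => (x, y)) = {x} ×ˢ univ := by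
    ext ⟨a, b⟩
    simp [eq_comm]
  rw [this]
  exact isClosed_singleton.prod isClosed_univ

/-- On every horizontal slice this is the integral over the whole of `F` of a directional derivative
of a compactly supported function. -/
theorem setIntegral_fderiv_horizontal {f : F × ℝ → ℝ} (hf : ContDiff ℝ 1 f)
    (hfc : HasCompactSupport f) (w : F) :
    ∫ p in {p : F × ℝ | p.2 < 0}, fderiv ℝ f p (w, 0) = 0 := by
  have hint : Integrable (fun p => fderiv ℝ f p (w, 0)) :=
    ((hf.continuous_fderiv one_ne_zero).clm_apply continuous_const).integrable_of_hasCompactSupport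
      (hfc.fderiv_apply (𝕜 := ℝ) (w, 0))
  have hset : {p : F × ℝ | p.2 < 0} = univ ×ˢ Iio 0 := by ext; simp
  rw [hset, Measure.volume_eq_prod, ← Measure.prod_restrict, Measure.restrict_univ,
    integral_prod_symm]
  · refine integral_eq_zero_of_ae (Filter.Eventually.of_forall fun s => ?_)
    have hk : ContDiff ℝ 1 fun y => f (y, s) := hf.comp (contDiff_id.prodMk contDiff_const)
    have hkc : HasCompactSupport fun y => f (y, s) :=
      hfc.comp_isClosedEmbedding (isClosedEmbedding_prodMk_const s)
    have hd : ∀ y, fderiv ℝ (fun y => f (y, s)) y w = fderiv ℝ f (y, s) (w, 0) := by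
      intro y
      have h1 : HasFDerivAt (fun y => f (y, s)) _ y :=
        (hf.differentiable one_ne_zero (y, s)).hasFDerivAt.comp y (hasFDerivAt_prodMk_left y s)
      rw [h1.fderiv]
      simp
    have h2 := integral_mul_fderiv_eq_neg_fderiv_mul_of_integrable (μ := (volume : Measure F))
      (f := fun _ => (1 : ℝ)) (g := fun y => f (y, s)) (v := w) (by simp)
      (by
        simp only [one_mul]
        exact ((hk.continuous_fderiv one_ne_zero).clm_apply
          continuous_const).integrable_of_hasCompactSupport (hkc.fderiv_apply (𝕜 := ℝ) w))
      (by simpa using hk.continuous.integrable_of_hasCompactSupport hkc)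
      (fun x _ => by fun_prop) (fun x _ => hk.differentiable one_ne_zero x)
    simpa [hd] using h2
  · rw [← Measure.restrict_univ (μ := (volume : Measure F)), Measure.prod_restrict]
    exact hint.integrableOn

/-- The weight is constant on vertical lines, so the fundamental theorem of calculus on `(-∞, 0]`
leaves only the value at height `0`. -/
theorem setIntegral_fderiv_vertical {f : F × ℝ → ℝ} (hf : ContDiff ℝ 1 f)
    (hfc : HasCompactSupport f) {a : F → ℝ} (ha : Continuous a) :
    ∫ p in {p : F × ℝ | p.2 < 0}, a p.1 * fderiv ℝ f p (0, 1) = ∫ y, a y * f (y, 0) := by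
  have hint : Integrable (fun p : F × ℝ => a p.1 * fderiv ℝ f p (0, 1)) :=
    ((ha.comp continuous_fst).mul ((hf.continuous_fderiv one_ne_zero).clm_apply
      continuous_const)).integrable_of_hasCompactSupport
      (hfc.fderiv_apply (𝕜 := ℝ) (0, 1)).mul_left
  have hset : {p : F × ℝ | p.2 < 0} = univ ×ˢ Iio 0 := by ext; simp
  rw [hset, Measure.volume_eq_prod, ← Measure.prod_restrict, Measure.restrict_univ,
    integral_prod]
  · congr 1
    ext y
    dsimp only
    rw [integral_const_mul, ← integral_Iic_eq_integral_Iio]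
    congr 1
    have hk : ContDiff ℝ 1 fun s => f (y, s) := hf.comp (contDiff_const.prodMk contDiff_id)
    have hkc : HasCompactSupport fun s => f (y, s) :=
      hfc.comp_isClosedEmbedding (isClosedEmbedding_const_prodMk y)
    rw [← hkc.integral_Iic_deriv_eq hk 0]
    congr 1
    ext s
    have h1 : HasDerivAt (fun s => f (y, s)) (fderiv ℝ f (y, s) (0, 1)) s :=
      (hf.differentiable one_ne_zero (y, s)).hasFDerivAt.comp_hasDerivAt s
        ((hasDerivAt_const s y).prodMk (hasDerivAt_id s))
    rw [h1.deriv]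
  · rw [← Measure.restrict_univ (μ := (volume : Measure F)), Measure.prod_restrict]
    exact hint.integrableOn

/-- In sheared coordinates the derivative along `v = (w, c)` is the horizontal derivative along `w`
plus `c - ⟨∇h, w⟩` times the vertical one. The first integrates to zero. The coefficient of the
second is the area density times `⟨normal, v⟩`, which is the surface integrand. -/
theorem setIntegral_subgraph_fderiv {ι : F →ₗᵢ[ℝ] E} {e : E} (hf : IsFrame ι e) {h : F → ℝ}
    (hh : ContDiff ℝ 1 h) {f : E → ℝ} (hfd : ContDiff ℝ 1 f) (hfc : HasCompactSupport f) (v : E) :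
    ∫ x in {x | ((frameEquiv hf).symm x).2 < h ((frameEquiv hf).symm x).1}, fderiv ℝ f x v =
      ∫ x in range (graphMap ι e h),
        f x * inner ℝ (graphNormal ι e h ((frameEquiv hf).symm x).1) v ∂μHE[finrank ℝ F] := by
  set Θ := graphHomeomorph hf hh.continuous with hΘ
  obtain ⟨⟨w, c⟩, rfl⟩ := (frameEquiv hf).surjective v
  have hpre : Θ ⁻¹' {x | ((frameEquiv hf).symm x).2 < h ((frameEquiv hf).symm x).1} =
      {p : F × ℝ | p.2 < 0} := by
    ext p
    simp [hΘ, graphHomeomorph_apply]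
  rw [← (measurePreserving_graphHomeomorph hf hh.continuous).setIntegral_preimage_emb
    Θ.measurableEmbedding, hpre, setIntegral_range_graphMap hf hh]
  have hΘd : ∀ p, HasFDerivAt Θ ((frameEquiv hf : F × ℝ →L[ℝ] E).comp
      ((ContinuousLinearMap.fst ℝ F ℝ).prod
        ((fderiv ℝ h p.1).comp (ContinuousLinearMap.fst ℝ F ℝ) + ContinuousLinearMap.snd ℝ F ℝ)))
      p := by
    intro p
    refine (frameEquiv hf : F × ℝ →L[ℝ] E).hasFDerivAt.comp p ?_
    exact hasFDerivAt_fst.prodMk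
      (((hh.differentiable one_ne_zero p.1).hasFDerivAt.comp p hasFDerivAt_fst).add hasFDerivAt_snd)
  have hΘc : ContDiff ℝ 1 Θ := by
    have : ContDiff ℝ 1 fun p : F × ℝ => frameEquiv hf (p.1, h p.1 + p.2) :=
      (frameEquiv hf).contDiff.comp (contDiff_fst.prodMk ((hh.comp contDiff_fst).add contDiff_snd))
    exact this
  set g : F × ℝ → ℝ := f ∘ Θ with hg
  have hgd : ContDiff ℝ 1 g := hfd.comp hΘc
  have hgc : HasCompactSupport g := hfc.comp_homeomorph Θ
  have hder : ∀ p : F × ℝ, fderiv ℝ f (Θ p) (frameEquiv hf (w, c)) =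
      fderiv ℝ g p (w, 0) + (c - inner ℝ (gradient h p.1) w) * fderiv ℝ g p (0, 1) := by
    intro p
    have h1 := ((hfd.differentiable one_ne_zero (Θ p)).hasFDerivAt.comp p (hΘd p)).fderiv
    rw [hg, h1, inner_gradient, ← smul_eq_mul, ← map_smul, ← map_add]
    simp
  refine (integral_congr_ae (Filter.Eventually.of_forall hder)).trans ?_
  have hcont : Continuous fun y => c - inner ℝ (gradient h y) w := by
    have := continuous_gradient hh
    fun_prop
  rw [integral_add, setIntegral_fderiv_horizontal hgd hgc,
    setIntegral_fderiv_vertical hgd hgc hcont, zero_add]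
  · congr 1
    ext y
    have h1 : g (y, 0) = f (graphMap ι e h y) := by
      simp [hg, hΘ, graphHomeomorph_apply, graphMap_eq hf]
    have h2 : graphDensity h y * inner ℝ (graphNormal ι e h y) (frameEquiv hf (w, c)) =
        c - inner ℝ (gradient h y) w := by
      rw [graphNormal, inner_smul_left]
      have h3 : e - ι (gradient h y) = frameEquiv hf (-gradient h y, 1) := by
        rw [frameEquiv_apply]
        simp [sub_eq_neg_add]
      rw [h3, frameEquiv_inner]
      have := (graphDensity_pos h y).ne'
      simp
      field_simp
      ring
    have h4 : ((frameEquiv hf).symm (graphMap ι e h y)).1 = y := by simp [graphMap_eq hf]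
    rw [h1, h4, ← h2]
    ring
  · exact (((hgd.continuous_fderiv one_ne_zero).clm_apply
      continuous_const).integrable_of_hasCompactSupport
      (hgc.fderiv_apply (𝕜 := ℝ) (w, 0))).integrableOn
  · exact (((hcont.comp continuous_fst).mul ((hgd.continuous_fderiv one_ne_zero).clm_apply
      continuous_const)).integrable_of_hasCompactSupport
      (hgc.fderiv_apply (𝕜 := ℝ) (0, 1)).mul_left).integrableOn

end

/-! ### Local defining functions -/

/-- A nonzero value would keep its sign nearby, putting a whole neighbourhood of `p` outside or
inside `U`. -/
theorem IsLocalDefiningFunction.eq_zero {U : Set E3} {p : E3} {g : E3 → ℝ}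
    (hg : IsLocalDefiningFunction U p g) (hp : p ∈ frontier U) : g p = 0 := by
  have hc : Continuous g := hg.1.continuous
  refine le_antisymm ?_ ?_
  · by_contra! h
    have h1 : ∀ᶠ x in 𝓝 p, x ∉ U := by
      filter_upwards [hg.2.2, hc.continuousAt.eventually_const_lt h] with x hx hx'
      rw [hx]
      exact not_lt.2 hx'.le
    have h2 := mem_closure_iff_frequently.1 (frontier_subset_closure hp)
    exact h2 h1
  · by_contra! h
    have h1 : ∀ᶠ x in 𝓝 p, x ∈ U := by
      filter_upwards [hg.2.2, hc.continuousAt.eventually_lt_const h] with x hx hx'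
      rwa [hx]
    exact hp.2 (mem_interior_iff_mem_nhds.2 h1)

theorem hasDerivAt_inner_gradient {g : E3 → ℝ} (hg : ContDiff ℝ ∞ g) (p v : E3) :
    HasDerivAt (fun s : ℝ => g (p + s • v)) (inner ℝ (gradient g p) v) 0 := by
  have := (hg.differentiable (by simp) p).hasFDerivAt.hasLineDerivAt v
  rw [inner_gradient]
  exact this

theorem IsLocalDefiningFunction.eventually_mem {U : Set E3} {p : E3} {g : E3 → ℝ}
    (hg : IsLocalDefiningFunction U p g) (hp : p ∈ frontier U) {v : E3}
    (hv : inner ℝ (gradient g p) v < 0) : ∀ᶠ s : ℝ in 𝓝[>] 0, p + s • v ∈ U := by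
  have hlim : Filter.Tendsto (fun s : ℝ => p + s • v) (𝓝[>] 0) (𝓝 p) := by
    have : Continuous fun s : ℝ => p + s • v := by fun_prop
    simpa using (this.tendsto 0).mono_left nhdsWithin_le_nhds
  have h1 := (hasDerivAt_inner_gradient hg.1 p v).tendsto_slope_zero_right
  filter_upwards [hlim.eventually hg.2.2, h1.eventually_lt_const hv, self_mem_nhdsWithin]
    with s h2 h3 h4
  have hs : (0 : ℝ) < s := h4
  rw [h2]
  simp only [zero_add, zero_smul, add_zero, hg.eq_zero hp, sub_zero, smul_eq_mul] at h3
  by_contra! h5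
  have := mul_nonneg (inv_nonneg.2 hs.le) h5
  linarith

/-- If the unit gradients differed, their difference would be a direction along which `g` decreases
and `g'` increases, so points just off `p` in that direction would lie both in `U` and outside it.
This makes the choice in `outerNormal` harmless. -/
theorem IsLocalDefiningFunction.normalize_gradient_eq {U : Set E3} {p : E3} {g g' : E3 → ℝ}
    (hg : IsLocalDefiningFunction U p g) (hg' : IsLocalDefiningFunction U p g')
    (hp : p ∈ frontier U) :
    ‖gradient g p‖⁻¹ • gradient g p = ‖gradient g' p‖⁻¹ • gradient g' p := by
  set a := gradient g p with ha
  set b := gradient g' p with hb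
  have ha0 : 0 < ‖a‖ := norm_pos_iff.2 hg.2.1
  have hb0 : 0 < ‖b‖ := norm_pos_iff.2 hg'.2.1
  have ha1 : ‖‖a‖⁻¹ • a‖ = 1 := norm_smul_inv_norm (𝕜 := ℝ) hg.2.1
  have hb1 : ‖‖b‖⁻¹ • b‖ = 1 := norm_smul_inv_norm (𝕜 := ℝ) hg'.2.1
  by_contra hne
  have hlt : inner ℝ (‖a‖⁻¹ • a) (‖b‖⁻¹ • b) < 1 := inner_lt_one_iff_real_of_norm_eq_one ha1 hb1 |>.2 hne
  set v := ‖b‖⁻¹ • b - ‖a‖⁻¹ • a with hv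
  have hav : inner ℝ a v < 0 := by
    have h1 : a = ‖a‖ • (‖a‖⁻¹ • a) := by rw [smul_smul, mul_inv_cancel₀ ha0.ne', one_smul]
    rw [h1, inner_smul_left, hv, inner_sub_right, real_inner_self_eq_norm_sq, ha1]
    simp only [conj_trivial]
    nlinarith
  have hbv : 0 < inner ℝ b v := by
    have h1 : b = ‖b‖ • (‖b‖⁻¹ • b) := by rw [smul_smul, mul_inv_cancel₀ hb0.ne', one_smul]
    rw [h1, inner_smul_left, hv, inner_sub_right, real_inner_self_eq_norm_sq, hb1,
      real_inner_comm]
    simp only [conj_trivial]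
    nlinarith
  have hlim : Filter.Tendsto (fun s : ℝ => p + s • v) (𝓝[>] 0) (𝓝 p) := by
    have : Continuous fun s : ℝ => p + s • v := by fun_prop
    simpa using (this.tendsto 0).mono_left nhdsWithin_le_nhds
  have h1 := (hasDerivAt_inner_gradient hg'.1 p v).tendsto_slope_zero_right
  obtain ⟨s, h2, h3, h4, h5⟩ := ((hg.eventually_mem hp hav).and ((hlim.eventually hg'.2.2).and
    ((h1.eventually_const_lt hbv).and self_mem_nhdsWithin))).exists
  have hs : (0 : ℝ) < s := h5
  rw [h3] at h2
  simp only [zero_add, zero_smul, add_zero, hg'.eq_zero hp, sub_zero, smul_eq_mul] at h4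
  have := mul_nonneg (inv_nonneg.2 hs.le) (neg_nonneg.2 h2.le)
  linarith

theorem IsLocalDefiningFunction.outerNormal_eq {U : Set E3} {p : E3} {g : E3 → ℝ}
    (hg : IsLocalDefiningFunction U p g) (hp : p ∈ frontier U) :
    outerNormal U p = ‖gradient g p‖⁻¹ • gradient g p := by
  have h : ∃ g, IsLocalDefiningFunction U p g := ⟨g, hg⟩
  rw [outerNormal, dif_pos h]
  exact h.choose_spec.normalize_gradient_eq hg hp

theorem contDiff_gradient {g : E3 → ℝ} (hg : ContDiff ℝ ∞ g) : ContDiff ℝ ∞ (gradient g) :=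
  (InnerProductSpace.toDual ℝ E3).symm.contDiff.comp (hg.fderiv_right (m := ∞) (by simp))

theorem IsLocalDefiningFunction.eventually {U : Set E3} {p : E3} {g : E3 → ℝ}
    (hg : IsLocalDefiningFunction U p g) : ∀ᶠ x in 𝓝 p, IsLocalDefiningFunction U x g := by
  filter_upwards [hg.2.2.eventually_nhds,
    (contDiff_gradient hg.1).continuous.continuousAt.eventually_ne hg.2.1] with x h1 h2
  exact ⟨hg.1, h2, h1⟩

/-! ### The boundary is locally a graph -/

theorem exists_isFrame {e : E3} (he : ‖e‖ = 1) :
    ∃ ι : EuclideanSpace ℝ (Fin 2) →ₗᵢ[ℝ] E3, IsFrame ι e := by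
  have he0 : e ≠ 0 := by
    rintro rfl
    simp at he
  have : Fact (finrank ℝ E3 = 2 + 1) := ⟨by simp⟩
  have h1 : finrank ℝ (ℝ ∙ e)ᗮ = 2 := Submodule.finrank_orthogonal_span_singleton (n := 2) he0
  set b := (stdOrthonormalBasis ℝ (ℝ ∙ e)ᗮ).reindex (finCongr h1)
  refine ⟨(ℝ ∙ e)ᗮ.subtypeₗᵢ.comp b.repr.symm.toLinearIsometry, he, fun y => ?_, by simp⟩
  rw [real_inner_comm]
  exact Submodule.mem_orthogonal_singleton_iff_inner_right.1 (b.repr.symm y).2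

theorem contDiff_of_forall_mem_tsupport {F G : Type*} [NormedAddCommGroup F] [NormedSpace ℝ F]
    [NormedAddCommGroup G] [NormedSpace ℝ G] {n : WithTop ℕ∞} {f : F → G}
    (h : ∀ y ∈ tsupport f, ContDiffAt ℝ n f y) : ContDiff ℝ n f := by
  refine contDiff_iff_contDiffAt.2 fun y => ?_
  by_cases hy : y ∈ tsupport f
  · exact h y hy
  · exact contDiffAt_const.congr_of_eventuallyEq (notMem_tsupport_iff_eventuallyEq.1 hy)

/-- Multiplication by a bump function turns a local object (implicit function, unit normal) into a
globally smooth one with the same germ, so that global lemmas apply. -/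
theorem exists_contDiff_eventuallyEq {F : Type*} [NormedAddCommGroup F] [InnerProductSpace ℝ F]
    [FiniteDimensional ℝ F] {G : Type*} [NormedAddCommGroup G] [NormedSpace ℝ G]
    {n : ℕ∞} {f : F → G} {p : F} (hf : ∀ᶠ y in 𝓝 p, ContDiffAt ℝ n f y) :
    ∃ h : F → G, ContDiff ℝ n h ∧ h =ᶠ[𝓝 p] f := by
  obtain ⟨r, hr, hball⟩ := Metric.eventually_nhds_iff_ball.1 hf
  let b : ContDiffBump p := ⟨r / 4, r / 2, by positivity, by linarith⟩
  refine ⟨fun y => b y • f y, contDiff_of_forall_mem_tsupport fun y hy => ?_, ?_⟩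
  · have hy' : y ∈ Metric.closedBall p (r / 2) := by
      rw [← b.tsupport_eq]
      exact tsupport_smul_subset_left _ _ hy
    exact b.contDiffAt.smul
      (hball y (Metric.closedBall_subset_ball (by linarith) hy'))
  · filter_upwards [b.eventuallyEq_one] with y hy
    simp [hy]

/-- The implicit function theorem gives the zero set as a graph. In a cylinder where the derivative
along `e` is positive, `g` is strictly increasing on vertical segments, so its sign tells on which
side of the graph a point lies. -/
theorem exists_graph_of_inner_gradient_pos {F : Type*} [NormedAddCommGroup F]
    [InnerProductSpace ℝ F] [FiniteDimensional ℝ F] {ι : F →ₗᵢ[ℝ] E3} {e : E3}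
    (hf : IsFrame ι e) {g : E3 → ℝ} (hg : ContDiff ℝ ∞ g) {p : E3} (hp : g p = 0)
    (hpe : 0 < inner ℝ (gradient g p) e) :
    ∃ (h : F → ℝ) (C : Set E3), ContDiff ℝ 1 h ∧ IsOpen C ∧ p ∈ C ∧
      ∀ x ∈ C, (g x < 0 ↔ ((frameEquiv hf).symm x).2 < h ((frameEquiv hf).symm x).1) ∧
        0 < inner ℝ (gradient g x) e := by
  set Ψ := frameEquiv hf with hΨ
  set f : F × ℝ → ℝ := g ∘ Ψ with hfd
  have hfs : ContDiff ℝ 1 f := (hg.of_le (by simp)).comp Ψ.contDiff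
  have hΨe : Ψ (0, 1) = e := by simp [hΨ, frameEquiv_apply]
  have hds : ∀ q : F × ℝ, fderiv ℝ f q (0, 1) = inner ℝ (gradient g (Ψ q)) e := by
    intro q
    have h1 : HasFDerivAt f ((fderiv ℝ g (Ψ q)).comp (Ψ : F × ℝ →L[ℝ] E3)) q :=
      (hg.differentiable (by simp) (Ψ q)).hasFDerivAt.comp q Ψ.hasFDerivAt
    rw [h1.fderiv, inner_gradient, ← hΨe]
    rfl
  set u := Ψ.symm p with hu
  have hΨu : Ψ u = p := by simp [hu]
  have hinv : (fderiv ℝ f u ∘L .inr ℝ F ℝ).IsInvertible := by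
    have hc : fderiv ℝ f u (0, 1) ≠ 0 := by
      rw [hds, hΨu]
      exact hpe.ne'
    refine ⟨ContinuousLinearEquiv.unitsEquivAut ℝ (Units.mk0 _ hc), ?_⟩
    ext
    simp
  have cdf : ContDiffAt ℝ 1 f u := hfs.contDiffAt
  set ψ := cdf.implicitFunction one_ne_zero hinv with hψ
  have hψu : ψ u.1 = u.2 := cdf.implicitFunction_apply_self one_ne_zero hinv
  have hψd : ContDiffAt ℝ 1 ψ u.1 := cdf.contDiffAt_implicitFunction one_ne_zero hinv
  have hψ0 : ∀ᶠ y in 𝓝 u.1, f (y, ψ y) = 0 := by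
    filter_upwards [cdf.eventually_apply_implicitFunction one_ne_zero hinv] with y hy
    rw [hy, hfd, Function.comp_apply, hΨu, hp]
  obtain ⟨h, hh, hhψ⟩ := exists_contDiff_eventuallyEq (n := 1) (hψd.eventually (by simp))
  have hpos : ∀ᶠ q in 𝓝 u, 0 < fderiv ℝ f q (0, 1) := by
    refine ((hfs.continuous_fderiv one_ne_zero).clm_apply
      continuous_const).continuousAt.eventually_const_lt ?_
    change 0 < fderiv ℝ f u (0, 1)
    rw [hds, hΨu]
    exact hpe
  rw [← Prod.mk.eta (p := u), nhds_prod_eq] at hpos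
  obtain ⟨A, hA, B, hB, hAB⟩ := Filter.mem_prod_iff.1 hpos
  obtain ⟨η, hη, hηB⟩ := Metric.mem_nhds_iff.1 hB
  rw [Real.ball_eq_Ioo] at hηB
  -- The graph must stay within the height of the cylinder, since monotonicity compares a point with
  -- the point of the graph on the same vertical segment.
  have hcont : ∀ᶠ y in 𝓝 u.1, h y ∈ Ioo (u.2 - η) (u.2 + η) := by
    refine hh.continuous.continuousAt.eventually_mem (Ioo_mem_nhds ?_ ?_)
    all_goals
      rw [hhψ.eq_of_nhds, hψu]
      linarith
  obtain ⟨δ, hδ, hδA⟩ := Metric.eventually_nhds_iff_ball.1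
    (hhψ.and (hψ0.and (hcont.and (Filter.eventually_mem_set.2 hA))))
  refine ⟨h, Ψ.symm ⁻¹' (Metric.ball u.1 δ ×ˢ Ioo (u.2 - η) (u.2 + η)), hh,
    (Metric.isOpen_ball.prod isOpen_Ioo).preimage Ψ.symm.continuous, ?_, ?_⟩
  · exact ⟨Metric.mem_ball_self hδ, by constructor <;> linarith⟩
  · intro x hx
    obtain ⟨h1, h2, h3, h4⟩ := hδA _ hx.1
    set q := Ψ.symm x with hq
    have hΨq : Ψ q = x := by simp [hq]
    have hgt : 0 < fderiv ℝ f q (0, 1) := hAB (mk_mem_prod h4 (hηB hx.2))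
    refine ⟨?_, by rwa [hds, hΨq] at hgt⟩
    have hmono : StrictMonoOn (fun s => f (q.1, s)) (Ioo (u.2 - η) (u.2 + η)) := by
      refine strictMonoOn_of_deriv_pos (convex_Ioo _ _) ?_ ?_
      · exact (hfs.continuous.comp (by fun_prop)).continuousOn
      · intro s hs
        rw [interior_Ioo] at hs
        have h1 : HasDerivAt (fun s => f (q.1, s)) (fderiv ℝ f (q.1, s) (0, 1)) s :=
          (hfs.differentiable one_ne_zero (q.1, s)).hasFDerivAt.comp_hasDerivAt s
            ((hasDerivAt_const s q.1).prodMk (hasDerivAt_id s))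
        rw [h1.deriv]
        exact hAB (mk_mem_prod h4 (hηB hs))
    have h5 : f q < f (q.1, h q.1) ↔ q.2 < h q.1 := hmono.lt_iff_lt hx.2 h3
    rw [h1, h2, ← h1] at h5
    rw [← h5, hfd, Function.comp_apply, hΨq]

/-- What the proof uses about the boundary of a smooth domain `U` near one of its points: in the
open set `C` the field `N` is a smooth extension of the outer normal, and the divergence theorem
holds for functions supported in `C`. -/
structure IsBoundaryChart (U C : Set E3) (N : E3 → E3) : Prop where
  isOpen : IsOpen C
  contDiff_normal : ContDiff ℝ ∞ N
  norm_normal : ∀ x ∈ C, ‖N x‖ = 1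
  outerNormal_eq : ∀ x ∈ C, x ∈ frontier U → outerNormal U x = N x
  integral_fderiv : ∀ f : E3 → ℝ, ContDiff ℝ 1 f → HasCompactSupport f → tsupport f ⊆ C → ∀ v,
    ∫ x in U, fderiv ℝ f x v = ∫ x in frontier U, f x * inner ℝ (N x) v ∂μHE[2]
  volume_frontier : volume (C ∩ frontier U) = 0
  measure_lt_top : ∀ K ⊆ C, IsCompact K → μHE[2] (K ∩ frontier U) < ⊤
  measure_pos : ∀ V, IsOpen V → ∀ x ∈ C, x ∈ frontier U → x ∈ V → 0 < μHE[2] (V ∩ frontier U)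
  mem_tangentCone : ∀ x ∈ C, x ∈ frontier U → ∀ v, inner ℝ (N x) v = 0 →
    v ∈ tangentConeAt ℝ (frontier U) x

theorem IsBoundaryChart.mono {U C C' : Set E3} {N : E3 → E3} (hC : IsBoundaryChart U C N)
    (hC' : IsOpen C') (h : C' ⊆ C) : IsBoundaryChart U C' N where
  isOpen := hC'
  contDiff_normal := hC.contDiff_normal
  norm_normal x hx := hC.norm_normal x (h hx)
  outerNormal_eq x hx := hC.outerNormal_eq x (h hx)
  integral_fderiv f h1 h2 h3 := hC.integral_fderiv f h1 h2 (h3.trans h)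
  volume_frontier := measure_mono_null (inter_subset_inter_left _ h) hC.volume_frontier
  measure_lt_top K hK := hC.measure_lt_top K (hK.trans h)
  measure_pos V hV x hx := hC.measure_pos V hV x (h hx)
  mem_tangentCone x hx := hC.mem_tangentCone x (h hx)

theorem mem_frontier_iff_of_subgraph {F : Type*} [NormedAddCommGroup F]
    [InnerProductSpace ℝ F] [FiniteDimensional ℝ F] {ι : F →ₗᵢ[ℝ] E3} {e : E3}
    (hf : IsFrame ι e) {h : F → ℝ} (hh : Continuous h) {U C : Set E3} (hU : IsOpen U)
    (hC : IsOpen C)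
    (hUC : ∀ x ∈ C, (x ∈ U ↔ ((frameEquiv hf).symm x).2 < h ((frameEquiv hf).symm x).1))
    {x : E3} (hx : x ∈ C) : x ∈ frontier U ↔ x ∈ range (graphMap ι e h) := by
  rw [range_graphMap hf, mem_ofPred_eq]
  have hc1 : Continuous fun x : E3 => ((frameEquiv hf).symm x).1 := by fun_prop
  have hc2 : Continuous fun x : E3 => ((frameEquiv hf).symm x).2 := by fun_prop
  constructor
  · intro hxf
    refine le_antisymm ?_ ?_
    · by_contra! hlt
      have h1 : ∀ᶠ y in 𝓝 x, y ∉ U := by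
        filter_upwards [hC.mem_nhds hx,
          (hh.comp hc1).continuousAt.eventually_lt hc2.continuousAt hlt] with y hy hy'
        rw [hUC y hy]
        exact not_lt.2 hy'.le
      exact mem_closure_iff_frequently.1 (frontier_subset_closure hxf) h1
    · by_contra! hlt
      have h1 : x ∈ U := (hUC x hx).2 hlt
      exact hxf.2 (by rwa [hU.interior_eq])
  · intro hxe
    rw [hU.frontier_eq]
    refine ⟨?_, fun h1 => ((hUC x hx).1 h1).ne hxe⟩
    have hlim : Filter.Tendsto (fun s : ℝ => x + s • e) (𝓝[<] 0) (𝓝 x) := by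
      have : Continuous fun s : ℝ => x + s • e := by fun_prop
      simpa using (this.tendsto 0).mono_left nhdsWithin_le_nhds
    refine mem_closure_of_tendsto hlim ?_
    filter_upwards [hlim.eventually (hC.mem_nhds hx), self_mem_nhdsWithin] with s hs hs'
    rw [hUC _ hs]
    have h1 : (frameEquiv hf).symm (x + s • e) = (frameEquiv hf).symm x + (0, s) := by
      rw [map_add, map_smul]
      congr 1
      rw [← map_smul, ContinuousLinearEquiv.symm_apply_eq, frameEquiv_apply]
      simp
    rw [h1]
    simp only [Prod.fst_add, Prod.snd_add, add_zero]
    rw [hxe]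
    have : s < 0 := hs'
    linarith

/-- Differentiating `g = 0` along the graph shows that the horizontal part of the gradient is `-c
∇h`, with `c > 0` its vertical part. Hence the gradient is `c (e - ι ∇h)`, and normalization removes
`c`. -/
theorem graphNormal_eq_of_level {F : Type*} [NormedAddCommGroup F]
    [InnerProductSpace ℝ F] [FiniteDimensional ℝ F] {ι : F →ₗᵢ[ℝ] E3} {e : E3}
    (hf : IsFrame ι e) {h : F → ℝ} (hh : ContDiff ℝ 1 h) {g : E3 → ℝ} (hg : ContDiff ℝ ∞ g) {y : F}
    (hgy : ∀ᶠ z in 𝓝 y, g (graphMap ι e h z) = 0)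
    (hpos : 0 < inner ℝ (gradient g (graphMap ι e h y)) e) :
    graphNormal ι e h y = ‖gradient g (graphMap ι e h y)‖⁻¹ • gradient g (graphMap ι e h y) := by
  set a := gradient g (graphMap ι e h y) with ha
  obtain ⟨⟨a₁, c⟩, hac⟩ := (frameEquiv hf).surjective a
  have hΨe : frameEquiv hf (0, 1) = e := by simp [frameEquiv_apply]
  have hc : 0 < c := by
    have h1 := frameEquiv_inner hf (a₁, c) (0, 1)
    rw [hac, hΨe] at h1
    rw [h1] at hpos
    simpa using hpos
  have h1 : HasFDerivAt (g ∘ graphMap ι e h) _ y :=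
    (hg.differentiable (by simp) _).hasFDerivAt.comp y (hasFDerivAt_graphMap ι e hh y)
  have h2 : HasFDerivAt (g ∘ graphMap ι e h) (0 : F →L[ℝ] ℝ) y :=
    (hasFDerivAt_const (0 : ℝ) y).congr_of_eventuallyEq hgy
  have h3 := h1.unique h2
  have h4 : a₁ + c • gradient h y = 0 := by
    refine ext_inner_right ℝ fun w => ?_
    have h5 := congrArg (fun L => L w) h3
    simp only [ContinuousLinearMap.comp_apply, _root_.add_apply,
      ContinuousLinearMap.smulRight_apply, LinearIsometry.coe_toContinuousLinearMap,
      _root_.zero_apply] at h5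
    rw [← inner_gradient (h := g), ← ha, ← hac] at h5
    have h6 := frameEquiv_inner hf (a₁, c) (w, fderiv ℝ h y w)
    rw [frameEquiv_apply hf (w, _)] at h6
    rw [h6] at h5
    rw [inner_add_left, inner_smul_left, inner_gradient, inner_zero_left]
    simpa using h5
  have h7 : a = c • (e - ι (gradient h y)) := by
    rw [← hac, frameEquiv_apply, eq_neg_of_add_eq_zero_left h4]
    simp only [map_neg, map_smul]
    module
  have h8 : ‖e - ι (gradient h y)‖ = graphDensity h y := by
    have h9 := hf.norm_sq (-gradient h y) 1
    rw [graphDensity, eq_comm, Real.sqrt_eq_iff_eq_sq (by positivity) (norm_nonneg _)]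
    simp only [map_neg, one_smul, norm_neg] at h9
    rw [sub_eq_neg_add, h9]
    ring
  rw [h7, norm_smul, h8, smul_smul, graphNormal, Real.norm_eq_abs, abs_of_pos hc, mul_inv,
    mul_comm c⁻¹, mul_assoc, inv_mul_cancel₀ hc.ne', mul_one]

theorem IsSmoothBoundedDomain.exists_isBoundaryChart {U : Set E3} (hU : IsSmoothBoundedDomain U)
    {p : E3} (hp : p ∈ frontier U) : ∃ C N, p ∈ C ∧ IsBoundaryChart U C N := by
  obtain ⟨g, hg⟩ := hU.smooth_boundary p hp
  have hgrad := contDiff_gradient hg.1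
  have hgn : 0 < ‖gradient g p‖ := norm_pos_iff.2 hg.2.1
  -- Taking the unit gradient at `p` as the vertical direction makes the vertical derivative of `g`
  -- positive there.
  obtain ⟨ι, hf⟩ := exists_isFrame (e := ‖gradient g p‖⁻¹ • gradient g p)
    (norm_smul_inv_norm (𝕜 := ℝ) hg.2.1)
  set e := ‖gradient g p‖⁻¹ • gradient g p with he
  have hpe : 0 < inner ℝ (gradient g p) e := by
    rw [he, inner_smul_right, real_inner_self_eq_norm_sq]
    positivity
  obtain ⟨h, C₀, hh, hC₀, hpC₀, hgC₀⟩ := exists_graph_of_inner_gradient_pos hf hg.1 (hg.eq_zero hp) hpe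
  obtain ⟨N, hN, hNeq⟩ : ∃ N : E3 → E3, ContDiff ℝ ∞ N ∧
      N =ᶠ[𝓝 p] fun x => ‖gradient g x‖⁻¹ • gradient g x := by
    refine exists_contDiff_eventuallyEq (n := ⊤) ?_
    filter_upwards [hgrad.continuous.continuousAt.eventually_ne hg.2.1] with x hx
    exact ((hgrad.contDiffAt.norm ℝ hx).inv (norm_ne_zero_iff.2 hx)).smul hgrad.contDiffAt
  obtain ⟨V, hV, hVo, hpV⟩ := eventually_nhds_iff.1 (hNeq.and hg.eventually)
  set C := C₀ ∩ V
  have hC : IsOpen C := hC₀.inter hVo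
  have hgU : ∀ x ∈ C, (x ∈ U ↔ ((frameEquiv hf).symm x).2 < h ((frameEquiv hf).symm x).1) := by
    intro x hx
    rw [← (hgC₀ x hx.1).1]
    exact (hV x hx.2).2.2.2.self_of_nhds
  have hfr : ∀ x ∈ C, (x ∈ frontier U ↔ x ∈ range (graphMap ι e h)) := fun x hx =>
    mem_frontier_iff_of_subgraph hf hh.continuous hU.isOpen hC hgU hx
  have hφ := (contDiff_graphMap ι e hh).continuous
  have hnormal : ∀ y, graphMap ι e h y ∈ C → graphNormal ι e h y = N (graphMap ι e h y) := by
    intro y hy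
    rw [(hV _ hy.2).1]
    refine graphNormal_eq_of_level hf hh hg.1 ?_ (hgC₀ _ hy.1).2
    filter_upwards [hφ.continuousAt.eventually_mem (hC.mem_nhds hy)] with z hz
    exact (hV _ hz.2).2.eq_zero ((hfr _ hz).2 ⟨z, rfl⟩)
  have hset : ∀ K ⊆ C, K ∩ frontier U = K ∩ range (graphMap ι e h) := by
    intro K hK
    ext x
    exact and_congr_right fun hx => hfr x (hK hx)
  have hfin : finrank ℝ (EuclideanSpace ℝ (Fin 2)) = 2 := by simp
  refine ⟨C, N, ⟨hpC₀, hpV⟩, hC, hN, ?_, ?_, ?_, ?_, ?_, ?_, ?_⟩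
  · intro x hx
    rw [(hV x hx.2).1]
    exact norm_smul_inv_norm (𝕜 := ℝ) (hV x hx.2).2.2.1
  · intro x hx hxf
    rw [(hV x hx.2).1]
    exact (hV x hx.2).2.outerNormal_eq hxf
  · intro f hfd hfc hfC v
    have h1 := setIntegral_subgraph_fderiv hf hh hfd hfc v
    rw [hfin] at h1
    have hc1 : Continuous fun x : E3 => h ((frameEquiv hf).symm x).1 := by
      have := hh.continuous
      fun_prop
    have hc2 : Continuous fun x : E3 => ((frameEquiv hf).symm x).2 := by fun_prop
    have h0 : ∀ x ∉ C, fderiv ℝ f x v = 0 := fun x hx => by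
      rw [fderiv_of_notMem_tsupport ℝ (fun h => hx (hfC h))]
      rfl
    have h0' : ∀ x ∉ C, f x = 0 := fun x hx => image_eq_zero_of_notMem_tsupport fun h => hx (hfC h)
    calc ∫ x in U, fderiv ℝ f x v
        = ∫ x in {x | ((frameEquiv hf).symm x).2 < h ((frameEquiv hf).symm x).1},
            fderiv ℝ f x v := by
          rw [← integral_indicator hU.isOpen.measurableSet,
            ← integral_indicator (isOpen_lt hc2 hc1).measurableSet]
          congr 1
          ext x
          by_cases hx : x ∈ C
          · by_cases hxU : x ∈ U
            · rw [indicator_of_mem hxU, indicator_of_mem]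
              exact (hgU x hx).1 hxU
            · rw [indicator_of_notMem hxU, indicator_of_notMem]
              exact mt (hgU x hx).2 hxU
          · simp only [indicator, h0 x hx, ite_self]
      _ = _ := h1
      _ = ∫ x in frontier U, f x * inner ℝ (N x) v ∂μHE[2] := by
          have hm : MeasurableSet (range (graphMap ι e h)) :=
            (measurableEmbedding_graphMap hf hh).measurableSet_range
          rw [← integral_indicator hm, ← integral_indicator isClosed_frontier.measurableSet]
          congr 1
          ext x
          by_cases hx : x ∈ C
          · by_cases hxf : x ∈ frontier U
            · have hxr := (hfr x hx).1 hxf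
              rw [indicator_of_mem hxf, indicator_of_mem hxr]
              obtain ⟨y, rfl⟩ := hxr
              rw [← hnormal y hx]
              simp [graphMap_eq hf]
            · rw [indicator_of_notMem hxf, indicator_of_notMem (mt (hfr x hx).2 hxf)]
          · simp only [indicator, h0' x hx, zero_mul, ite_self]
  · rw [hset C subset_rfl]
    exact measure_mono_null inter_subset_right (volume_range_graphMap hf hh.continuous)
  · intro K hK hKc
    have := euclideanHausdorffMeasure_range_graphMap_inter_lt_top hf hh hKc
    rw [hfin] at this
    rwa [hset K hK]
  · intro W hW x hx hxf hxW
    obtain ⟨y, rfl⟩ := (hfr x hx).1 hxf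
    have h1 := euclideanHausdorffMeasure_range_graphMap_inter_pos hf hh (hW.inter hC) ⟨hxW, hx⟩
    rw [hfin, ← hset _ inter_subset_right] at h1
    exact h1.trans_le (measure_mono (inter_subset_inter_left _ inter_subset_left))
  · intro x hx hxf v hv
    obtain ⟨y, rfl⟩ := (hfr x hx).1 hxf
    rw [← hnormal y hx] at hv
    obtain ⟨⟨w, c⟩, rfl⟩ := (frameEquiv hf).surjective v
    have h3 : e - ι (gradient h y) = frameEquiv hf (-gradient h y, 1) := by
      rw [frameEquiv_apply]
      simp [sub_eq_neg_add]
    rw [graphNormal, inner_smul_left, h3, frameEquiv_inner] at hv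
    have hd := (graphDensity_pos h y).ne'
    have hc : c = fderiv ℝ h y w := by
      rw [← inner_gradient]
      have h4 := (mul_eq_zero.1 hv).resolve_left (by simpa using hd)
      simp only [inner_neg_left, one_mul] at h4
      linarith
    have h5 : frameEquiv hf (w, c) =
        (ι.toContinuousLinearMap + (fderiv ℝ h y).smulRight e) w := by
      rw [frameEquiv_apply, hc]
      rfl
    rw [h5]
    -- The graph agrees with the boundary only inside `C`. Restricting the parametrization to the
    -- preimage of `C`, a neighbourhood of `y`, still reaches every tangent direction.
    have hnh : graphMap ι e h ⁻¹' C ∈ 𝓝 y := hφ.continuousAt.preimage_mem_nhds (hC.mem_nhds hx)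
    have h6 := (hasFDerivAt_graphMap ι e hh y).hasFDerivWithinAt
      (s := graphMap ι e h ⁻¹' C) |>.mapsTo_tangent_cone
    have h7 := h6 (x := w) (by rw [tangentConeAt_of_mem_nhds hnh]; exact mem_univ w)
    refine tangentConeAt_mono ?_ h7
    rintro _ ⟨z, hz, rfl⟩
    exact (hfr _ hz).2 ⟨z, rfl⟩

/-! ### Integrability and localization -/

theorem integrableOn_of_continuousOn_of_isCompact {μ : Measure E3} {S K : Set E3} (hSK : S ⊆ K) (hK : IsCompact K)
    (hμ : μ K < ⊤) {k : E3 → ℝ} (hk : ContinuousOn k K) : IntegrableOn k S μ := by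
  refine IntegrableOn.mono_set ?_ hSK
  obtain ⟨c, hc⟩ := (hK.image_of_continuousOn hk).isBounded.exists_norm_le
  have : IsFiniteMeasure (μ.restrict K) := ⟨by simpa using hμ⟩
  refine Integrable.of_bound (hk.aestronglyMeasurable hK.measurableSet) c ?_
  filter_upwards [ae_restrict_mem hK.measurableSet] with x hx
  exact hc _ (mem_image_of_mem k hx)

theorem IsSmoothBoundedDomain.isCompact_frontier {U : Set E3} (hU : IsSmoothBoundedDomain U) :
    IsCompact (frontier U) :=
  hU.isBounded.isCompact_closure.of_isClosed_subset isClosed_frontier frontier_subset_closure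

theorem IsSmoothBoundedDomain.measure_frontier_lt_top {U : Set E3}
    (hU : IsSmoothBoundedDomain U) : μHE[2] (frontier U) < ⊤ := by
  refine hU.isCompact_frontier.measure_lt_top_of_nhdsWithin fun p hp => ?_
  obtain ⟨C, N, hpC, hC⟩ := hU.exists_isBoundaryChart hp
  obtain ⟨K, hK, hpK, hKC⟩ := exists_compact_subset hC.isOpen hpC
  refine ⟨K ∩ frontier U, ?_, hC.measure_lt_top K hKC hK⟩
  exact Filter.inter_mem (mem_nhdsWithin_of_mem_nhds (mem_interior_iff_mem_nhds.1 hpK))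
    self_mem_nhdsWithin

theorem IsSmoothBoundedDomain.integrableOn_frontier {U : Set E3} (hU : IsSmoothBoundedDomain U)
    {k : E3 → ℝ} (hk : ContinuousOn k (frontier U)) : IntegrableOn k (frontier U) μHE[2] :=
  integrableOn_of_continuousOn_of_isCompact subset_rfl
    hU.isCompact_frontier hU.measure_frontier_lt_top hk

/-- The fundamental lemma of the calculus of variations gives vanishing almost everywhere.
Continuity and positivity of `μ` on relatively open pieces of `S` upgrade this to every point, for
volume and surface measure alike. -/
theorem eq_zero_of_forall_setIntegral_mul_eq_zero {μ : Measure E3} {S C : Set E3}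
    (hC : IsOpen C) (hμ : μ S < ⊤)
    (hpos : ∀ V, IsOpen V → ∀ x ∈ C, x ∈ S → x ∈ V → 0 < μ (V ∩ S))
    {k : E3 → ℝ} (hk : Continuous k)
    (h : ∀ ψ : E3 → ℝ, ContDiff ℝ ∞ ψ → HasCompactSupport ψ → tsupport ψ ⊆ C →
      ∫ x in S, ψ x * k x ∂μ = 0) {x : E3} (hxC : x ∈ C) (hxS : x ∈ S) : k x = 0 := by
  have : IsFiniteMeasure (μ.restrict S) := ⟨by simpa using hμ⟩
  have h1 : ∀ᵐ x ∂μ.restrict S, x ∈ C → k x = 0 :=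
    hC.ae_eq_zero_of_integral_contDiff_smul_eq_zero
      (hk.locallyIntegrable.locallyIntegrableOn C) h
  by_contra hne
  have hV : IsOpen (C ∩ {x | k x ≠ 0}) := hC.inter (isOpen_ne_fun hk continuous_const)
  have h2 := hpos _ hV x hxC hxS ⟨hxC, hne⟩
  refine h2.ne' ?_
  rw [← Measure.restrict_apply hV.measurableSet]
  refine measure_mono_null ?_ h1
  intro y hy h3
  exact hy.2 (h3 hy.1)

/-! ### Tangential derivatives -/

/-- Derivatives within a surface are not unique, but any two agree on its tangent cone. The
direction `e_j - n_j n` is orthogonal to the normal and hence lies in that cone. -/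
theorem surfaceD_eq_of_hasFDerivWithinAt {U : Set E3} (hU : IsSmoothBoundedDomain U) {x : E3}
    (hx : x ∈ frontier U) {f : E3 → ℝ} {f' : E3 →L[ℝ] ℝ}
    (hf : HasFDerivWithinAt f f' (frontier U) x) (j : Fin 3) :
    surfaceD U j f x = f' (basisVec j - outerNormal U x j • outerNormal U x) := by
  obtain ⟨C, N, hxC, hC⟩ := hU.exists_isBoundaryChart hx
  refine hf.differentiableWithinAt.hasFDerivWithinAt.unique_on hf
    (hC.mem_tangentCone x hxC hx _ ?_)
  rw [hC.outerNormal_eq x hxC hx, inner_sub_right, inner_smul_right, real_inner_self_eq_norm_sq,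
    hC.norm_normal x hxC, basisVec, EuclideanSpace.inner_single_right]
  simp

theorem surfaceD_eq {U : Set E3} (hU : IsSmoothBoundedDomain U) {x : E3}
    (hx : x ∈ frontier U) {f : E3 → ℝ} (hf : DifferentiableAt ℝ f x) (j : Fin 3) :
    surfaceD U j f x = fderiv ℝ f x (basisVec j - outerNormal U x j • outerNormal U x) :=
  surfaceD_eq_of_hasFDerivWithinAt hU hx hf.hasFDerivAt.hasFDerivWithinAt j

theorem continuousOn_outerNormal {U : Set E3} (hU : IsSmoothBoundedDomain U) :
    ContinuousOn (outerNormal U) (frontier U) := by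
  intro x hx
  obtain ⟨C, N, hxC, hC⟩ := hU.exists_isBoundaryChart hx
  refine (hC.contDiff_normal.continuous.continuousWithinAt (s := frontier U)).congr_of_eventuallyEq
    ?_ (hC.outerNormal_eq x hxC hx)
  filter_upwards [mem_nhdsWithin_of_mem_nhds (hC.isOpen.mem_nhds hxC), self_mem_nhdsWithin]
    with y hy hyf using hC.outerNormal_eq y hy hyf

theorem norm_outerNormal {U : Set E3} (hU : IsSmoothBoundedDomain U) {x : E3}
    (hx : x ∈ frontier U) : ‖outerNormal U x‖ = 1 := by
  obtain ⟨C, N, hxC, hC⟩ := hU.exists_isBoundaryChart hx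
  rw [hC.outerNormal_eq x hxC hx, hC.norm_normal x hxC]

theorem continuousOn_surfaceD {U : Set E3} (hU : IsSmoothBoundedDomain U) {f : E3 → ℝ}
    (hf : ContDiff ℝ 1 f) (j : Fin 3) : ContinuousOn (surfaceD U j f) (frontier U) := by
  have h1 := continuousOn_outerNormal hU
  have h2 : ContinuousOn (fun x => outerNormal U x j) (frontier U) :=
    (EuclideanSpace.proj (𝕜 := ℝ) j).continuous.comp_continuousOn h1
  refine ContinuousOn.congr (f := fun x =>
    fderiv ℝ f x (basisVec j - outerNormal U x j • outerNormal U x)) ?_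
    fun x hx => surfaceD_eq hU hx (hf.differentiable one_ne_zero x) j
  exact (hf.continuous_fderiv one_ne_zero).continuousOn.clm_apply
    (continuousOn_const.sub (h2.smul h1))

/-- The derivative of `f` in the direction `e_j - N_j N`. -/
noncomputable def tangentialD (N : E3 → E3) (j : Fin 3) (f : E3 → ℝ) (x : E3) : ℝ :=
  partialD j f x - N x j * ∑ k, N x k * partialD k f x

theorem fderiv_eq_sum_partialD (f : E3 → ℝ) (x v : E3) :
    fderiv ℝ f x v = ∑ k, v k * partialD k f x := by
  have h1 : v = ∑ k, v k • basisVec k := by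
    have := (EuclideanSpace.basisFun (Fin 3) ℝ).sum_repr v
    simpa [basisVec] using this.symm
  conv_lhs => rw [h1]
  simp [partialD]

theorem tangentialD_eq (N : E3 → E3) (j : Fin 3) (f : E3 → ℝ) (x : E3) :
    tangentialD N j f x = fderiv ℝ f x (basisVec j - N x j • N x) := by
  rw [map_sub, map_smul, fderiv_eq_sum_partialD f x (N x), tangentialD, smul_eq_mul]
  rfl

/-- Only values on the surface matter, so fields built from the normal may be replaced by smooth
extensions built from `N`. -/
theorem IsBoundaryChart.surfaceD_eq_tangentialD {U C : Set E3} {N : E3 → E3}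
    (hU : IsSmoothBoundedDomain U) (hC : IsBoundaryChart U C N) {x : E3} (hxC : x ∈ C)
    (hx : x ∈ frontier U) {f g : E3 → ℝ} (hg : DifferentiableAt ℝ g x)
    (hfg : ∀ y ∈ C, y ∈ frontier U → f y = g y) (j : Fin 3) :
    surfaceD U j f x = tangentialD N j g x := by
  rw [tangentialD_eq, ← hC.outerNormal_eq x hxC hx]
  refine surfaceD_eq_of_hasFDerivWithinAt hU hx ?_ j
  refine hg.hasFDerivAt.hasFDerivWithinAt.congr_of_eventuallyEq ?_ (hfg x hxC hx)
  filter_upwards [mem_nhdsWithin_of_mem_nhds (hC.isOpen.mem_nhds hxC), self_mem_nhdsWithin]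
    with y hy hyf using hfg y hy hyf

/-! ### Divergence theorems in a boundary chart -/

theorem contDiff_partialD {f : E3 → ℝ} (hf : ContDiff ℝ ∞ f) (j : Fin 3) :
    ContDiff ℝ ∞ (partialD j f) :=
  (hf.fderiv_right (m := ∞) (by simp)).clm_apply contDiff_const

theorem hasCompactSupport_partialD {f : E3 → ℝ} (hf : HasCompactSupport f) (j : Fin 3) :
    HasCompactSupport (partialD j f) := hf.fderiv_apply (𝕜 := ℝ) (basisVec j)

theorem tsupport_partialD_subset (f : E3 → ℝ) (j : Fin 3) :
    tsupport (partialD j f) ⊆ tsupport f := tsupport_fderiv_apply_subset ℝ (basisVec j)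

theorem partialD_mul {f g : E3 → ℝ} {x : E3} (hf : DifferentiableAt ℝ f x)
    (hg : DifferentiableAt ℝ g x) (j : Fin 3) :
    partialD j (fun y => f y * g y) x = partialD j f x * g x + f x * partialD j g x := by
  rw [partialD, fderiv_fun_mul hf hg]
  simp [partialD]
  ring

theorem partialD_sum {f : Fin 3 → E3 → ℝ} {x : E3} (hf : ∀ k, DifferentiableAt ℝ (f k) x)
    (j : Fin 3) : partialD j (fun y => ∑ k, f k y) x = ∑ k, partialD j (f k) x := by
  rw [partialD, fderiv_fun_sum fun k _ => hf k]
  simp [partialD]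

theorem partialD_comm {f : E3 → ℝ} (hf : ContDiff ℝ ∞ f) (i j : Fin 3) (x : E3) :
    partialD i (partialD j f) x = partialD j (partialD i f) x := by
  have h1 : ∀ a b : Fin 3, partialD a (partialD b f) x =
      fderiv ℝ (fderiv ℝ f) x (basisVec a) (basisVec b) := by
    intro a b
    have h2 : DifferentiableAt ℝ (fderiv ℝ f) x :=
      (hf.fderiv_right (m := ∞) (by simp)).differentiable (by simp) x
    have h3 : HasFDerivAt (partialD b f) _ x :=
      h2.hasFDerivAt.clm_apply (hasFDerivAt_const (basisVec b) x)
    rw [partialD, h3.fderiv]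
    simp
  rw [h1, h1]
  have h4 : IsSymmSndFDerivAt ℝ f x := (hf.contDiffAt).isSymmSndFDerivAt (by
    rw [minSmoothness_of_isRCLikeNormedField]
    exact WithTop.coe_le_coe.2 (le_top : (2 : ℕ∞) ≤ ⊤))
  exact h4 _ _

theorem integral_partialD_eq_zero {f : E3 → ℝ} (hf : ContDiff ℝ 1 f) (hfc : HasCompactSupport f)
    (j : Fin 3) : ∫ x, partialD j f x = 0 := by
  have h2 := integral_mul_fderiv_eq_neg_fderiv_mul_of_integrable (μ := (volume : Measure E3))
    (f := fun _ => (1 : ℝ)) (g := f) (v := basisVec j) (by simp)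
    (by
      simp only [one_mul]
      exact ((hf.continuous_fderiv one_ne_zero).clm_apply
        continuous_const).integrable_of_hasCompactSupport (hfc.fderiv_apply (𝕜 := ℝ) _))
    (by simpa using hf.continuous.integrable_of_hasCompactSupport hfc)
    (fun x _ => by fun_prop) (fun x _ => hf.differentiable one_ne_zero x)
  simpa [partialD] using h2

theorem IsBoundaryChart.setIntegral_partialD {U C : Set E3} {N : E3 → E3}
    (hC : IsBoundaryChart U C N) {f : E3 → ℝ} (hf : ContDiff ℝ ∞ f) (hfc : HasCompactSupport f)
    (hfC : tsupport f ⊆ C) (j : Fin 3) :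
    ∫ x in U, partialD j f x = ∫ x in frontier U, f x * N x j ∂μHE[2] := by
  have h1 := hC.integral_fderiv f (hf.of_le (by simp)) hfc hfC (basisVec j)
  simp only [basisVec, EuclideanSpace.inner_single_right, one_mul, conj_trivial] at h1
  exact h1

/-- The integral over all of space vanishes, and the boundary is null in `C`, so the exterior
contributes the negative of the interior. The outer boundary plays no role since the support lies in
`Ω`. -/
theorem IsBoundaryChart.setIntegral_partialD_exterior {Ω U C : Set E3} {N : E3 → E3}
    (hU : IsOpen U) (hΩ : IsOpen Ω) (hCΩ : C ⊆ Ω)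
    (hC : IsBoundaryChart U C N) {f : E3 → ℝ} (hf : ContDiff ℝ ∞ f) (hfc : HasCompactSupport f)
    (hfC : tsupport f ⊆ C) (j : Fin 3) :
    ∫ x in Ω \ closure U, partialD j f x = -∫ x in frontier U, f x * N x j ∂μHE[2] := by
  have hint : Integrable (partialD j f) :=
    (contDiff_partialD hf j).continuous.integrable_of_hasCompactSupport
      (hasCompactSupport_partialD hfc j)
  have h0 : ∀ x ∉ C, partialD j f x = 0 := fun x hx =>
    image_eq_zero_of_notMem_tsupport fun h => hx (hfC (tsupport_partialD_subset f j h))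
  have h1 : ∫ x in Ω \ closure U, partialD j f x = ∫ x in (closure U)ᶜ, partialD j f x := by
    rw [← integral_indicator (hΩ.measurableSet.diff isClosed_closure.measurableSet),
      ← integral_indicator isClosed_closure.measurableSet.compl]
    congr 1
    ext x
    by_cases hx : x ∈ C
    · by_cases hxU : x ∈ closure U
      · rw [indicator_of_notMem (show x ∉ Ω \ closure U from fun h => h.2 hxU), indicator_of_notMem (show x ∉ (closure U)ᶜ from fun h => h hxU)]
      · rw [indicator_of_mem (show x ∈ Ω \ closure U from ⟨hCΩ hx, hxU⟩),
          indicator_of_mem (show x ∈ (closure U)ᶜ from hxU)]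
    · rw [indicator_apply_eq_zero.2 fun _ => h0 x hx, indicator_apply_eq_zero.2 fun _ => h0 x hx]
  have h2 : ∫ x in closure U, partialD j f x = ∫ x in U, partialD j f x := by
    rw [← integral_indicator isClosed_closure.measurableSet,
      ← integral_indicator hU.measurableSet]
    refine integral_congr_ae ?_
    have hnull : ∀ᵐ x : E3, x ∉ C ∩ frontier U := measure_eq_zero_iff_ae_notMem.1 hC.volume_frontier
    filter_upwards [hnull] with x hx
    by_cases hxC : x ∈ C
    · have hxf : x ∉ frontier U := fun h => hx ⟨hxC, h⟩
      by_cases hxU : x ∈ U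
      · rw [indicator_of_mem hxU, indicator_of_mem (subset_closure hxU)]
      · have : x ∉ closure U := fun h => hxf ⟨h, by rwa [hU.interior_eq]⟩
        rw [indicator_of_notMem hxU, indicator_of_notMem this]
    · rw [indicator_apply_eq_zero.2 fun _ => h0 x hxC, indicator_apply_eq_zero.2 fun _ => h0 x hxC]
  have h3 := integral_add_compl (isClosed_closure (s := U)).measurableSet hint
  rw [integral_partialD_eq_zero (hf.of_le (by simp)) hfc, h2,
    hC.setIntegral_partialD hf hfc hfC] at h3
  rw [h1]
  linarith

/-- By the divergence theorem each term is a bulk integral of a second derivative of `f`, and mixed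
partial derivatives commute. -/
theorem IsBoundaryChart.setIntegral_partialD_antisymm {U C : Set E3} {N : E3 → E3}
    (hU : IsSmoothBoundedDomain U) (hC : IsBoundaryChart U C N) {f : E3 → ℝ} (hf : ContDiff ℝ ∞ f)
    (hfc : HasCompactSupport f) (hfC : tsupport f ⊆ C) (i j : Fin 3) :
    ∫ x in frontier U, (N x i * partialD j f x - N x j * partialD i f x) ∂μHE[2] = 0 := by
  have h1 : ∀ a b : Fin 3, ∫ x in frontier U, N x a * partialD b f x ∂μHE[2] =
      ∫ x in U, partialD a (partialD b f) x := by
    intro a b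
    rw [hC.setIntegral_partialD (contDiff_partialD hf b) (hasCompactSupport_partialD hfc b)
      ((tsupport_partialD_subset f b).trans hfC)]
    simp_rw [mul_comm]
  have hN : ∀ a, Continuous fun x => N x a := fun a =>
    (EuclideanSpace.proj (𝕜 := ℝ) a).continuous.comp hC.contDiff_normal.continuous
  have h2 : ∀ a b : Fin 3, IntegrableOn (fun x => N x a * partialD b f x) (frontier U) μHE[2] :=
    fun a b => hU.integrableOn_frontier
      ((hN a).mul (contDiff_partialD hf b).continuous).continuousOn
  rw [integral_sub (h2 i j) (h2 j i), h1, h1, sub_eq_zero]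
  simp_rw [partialD_comm hf i j]

/-- The divergence theorem on the surface `frontier U`, for tangential fields. -/
theorem IsBoundaryChart.setIntegral_tangential_divergence {U C : Set E3} {N : E3 → E3}
    (hU : IsSmoothBoundedDomain U) (hC : IsBoundaryChart U C N) {Y : Fin 3 → E3 → ℝ}
    (hY : ∀ j, ContDiff ℝ ∞ (Y j)) (hYc : ∀ j, HasCompactSupport (Y j))
    (hYC : ∀ j, tsupport (Y j) ⊆ C) (hYN : ∀ x ∈ C, ∑ j, Y j x * N x j = 0) :
    ∫ x in frontier U, ∑ j, tangentialD N j (Y j) x ∂μHE[2] = 0 := by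
  have hN : ∀ a, ContDiff ℝ ∞ fun x => N x a := fun a =>
    (EuclideanSpace.proj (𝕜 := ℝ) a).contDiff.comp hC.contDiff_normal
  have hNY : ∀ j k, ContDiff ℝ ∞ fun x => N x k * Y j x := fun j k => (hN k).mul (hY j)
  have hint : ∀ j k, IntegrableOn (fun x => N x k * partialD j (fun y => N y k * Y j y) x -
      N x j * partialD k (fun y => N y k * Y j y) x) (frontier U) μHE[2] := fun j k =>
    hU.integrableOn_frontier (((hN k).continuous.mul (contDiff_partialD (hNY j k) j).continuous).sub
      ((hN j).continuous.mul (contDiff_partialD (hNY j k) k).continuous)).continuousOn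
  -- The antisymmetric operators applied to `N_k Y_j` and summed over `j, k` reproduce the surface
  -- divergence of `Y`. The remaining terms contain `|N|² - 1`, its derivatives, or `(div N) (Y ·
  -- N)`, all zero in `C`.
  have h1 : ∫ x in frontier U, ∑ j, ∑ k, (N x k * partialD j (fun y => N y k * Y j y) x -
      N x j * partialD k (fun y => N y k * Y j y) x) ∂μHE[2] = 0 := by
    rw [integral_finsetSum _ fun j _ => integrable_finsetSum _ fun k _ => hint j k]
    refine Finset.sum_eq_zero fun j _ => ?_
    rw [integral_finsetSum _ fun k _ => hint j k]
    refine Finset.sum_eq_zero fun k _ => ?_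
    exact hC.setIntegral_partialD_antisymm hU (hNY j k) (hYc j).mul_left
      ((tsupport_mul_subset_right).trans (hYC j)) k j
  rw [← h1]
  congr 1
  ext x
  have hNd : ∀ a, DifferentiableAt ℝ (fun x => N x a) x := fun a => (hN a).differentiable (by simp) x
  have hYd : ∀ a, DifferentiableAt ℝ (Y a) x := fun a => (hY a).differentiable (by simp) x
  simp_rw [fun j k a => partialD_mul (hNd k) (hYd j) a]
  by_cases hx : x ∈ C
  · have hnorm : ∀ y ∈ C, ∑ k, N y k * N y k = 1 := by
      intro y hy
      have := hC.norm_normal y hy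
      rw [EuclideanSpace.norm_eq, Real.sqrt_eq_one] at this
      rw [← this]
      exact Finset.sum_congr rfl fun k _ => by rw [Real.norm_eq_abs, sq_abs, sq]
    -- Differentiate `|N|² = 1`, which holds on the open set `C` and not merely on the surface.
    have hperp : ∀ j, ∑ k, N x k * partialD j (fun y => N y k) x = 0 := by
      intro j
      have h2 : partialD j (fun y => ∑ k, N y k * N y k) x = 0 := by
        have h3 : (fun y => ∑ k, N y k * N y k) =ᶠ[𝓝 x] fun _ => 1 := by
          filter_upwards [hC.isOpen.mem_nhds hx] with y hy using hnorm y hy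
        rw [partialD, h3.fderiv_eq]
        simp
      have h4 : partialD j (fun y => ∑ k, N y k * N y k) x =
          ∑ k, partialD j (fun y => N y k * N y k) x :=
        partialD_sum (fun k => (hNd k).mul (hNd k)) j
      rw [h4] at h2
      simp_rw [fun k => partialD_mul (hNd k) (hNd k) j] at h2
      have h5 : ∑ k, (partialD j (fun y => N y k) x * N x k + N x k * partialD j (fun y => N y k) x)
          = 2 * ∑ k, N x k * partialD j (fun y => N y k) x := by
        rw [Finset.mul_sum]
        exact Finset.sum_congr rfl fun k _ => by ring
      rw [h5] at h2
      linarith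
    have h6 := hnorm x hx
    have h7 := hYN x hx
    have h8 := hperp 0
    have h9 := hperp 1
    have h10 := hperp 2
    simp only [Fin.sum_univ_three, tangentialD] at h6 h7 h8 h9 h10 ⊢
    linear_combination (-(partialD 0 (Y 0) x + partialD 1 (Y 1) x + partialD 2 (Y 2) x)) * h6 +
      (partialD 0 (fun y => N y 0) x + partialD 1 (fun y => N y 1) x +
        partialD 2 (fun y => N y 2) x) * h7 - Y 0 x * h8 - Y 1 x * h9 - Y 2 x * h10
  · have h2 : ∀ j, Y j x = 0 := fun j => image_eq_zero_of_notMem_tsupport fun h => hx (hYC j h)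
    have h3 : ∀ j k, partialD k (Y j) x = 0 := fun j k =>
      image_eq_zero_of_notMem_tsupport fun h => hx (hYC j (tsupport_partialD_subset _ k h))
    simp [tangentialD, h2, h3]

/-! ### Matrix identities -/

theorem frob_eq_trace (M N : Matrix (Fin 3) (Fin 3) ℝ) : frob M N = (Mᵀ * N).trace := by
  simp only [frob, Matrix.trace, Matrix.diag, Matrix.mul_apply, Matrix.transpose_apply]
  exact Finset.sum_comm

theorem frob_sum_transpose (G H : Matrix (Fin 3) (Fin 3) ℝ) :
    frob ((1 / 2 : ℝ) • (G + Gᵀ)) ((1 / 2 : ℝ) • (H + Hᵀ)) =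
      frob ((1 / 2 : ℝ) • (G + Gᵀ)) H := by
  simp only [frob, Fin.sum_univ_three, Matrix.smul_apply, Matrix.add_apply, Matrix.transpose_apply,
    smul_eq_mul]
  ring

theorem frob_one_left (M : Matrix (Fin 3) (Fin 3) ℝ) : frob 1 M = M.trace := by
  rw [frob_eq_trace, Matrix.transpose_one, Matrix.one_mul]

theorem frob_add_left (M M' N : Matrix (Fin 3) (Fin 3) ℝ) :
    frob (M + M') N = frob M N + frob M' N := by
  simp [frob_eq_trace, Matrix.add_mul]

theorem frob_sub_left (M M' N : Matrix (Fin 3) (Fin 3) ℝ) :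
    frob (M - M') N = frob M N - frob M' N := by
  simp [frob_eq_trace, Matrix.sub_mul]

theorem frob_smul_left (c : ℝ) (M N : Matrix (Fin 3) (Fin 3) ℝ) :
    frob (c • M) N = c * frob M N := by
  simp [frob_eq_trace]

/-- The left factor `D` is symmetric and satisfies `D P = D`, so it pairs with `P H` as with `H`.
This is why the variation of the surface dissipation involves the unprojected `∇_Γ φ`. -/
theorem frob_tangential {P G H : Matrix (Fin 3) (Fin 3) ℝ} (hPt : Pᵀ = P) (hPP : P * P = P)
    (hG : G * P = G) :
    frob ((1 / 2 : ℝ) • (P * G + (P * G)ᵀ)) ((1 / 2 : ℝ) • (P * H + (P * H)ᵀ)) =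
      frob ((1 / 2 : ℝ) • (P * G + (P * G)ᵀ)) H := by
  rw [frob_sum_transpose, frob_eq_trace, frob_eq_trace, ← Matrix.mul_assoc]
  congr 2
  rw [Matrix.transpose_smul, Matrix.transpose_add, Matrix.transpose_transpose,
    Matrix.smul_mul, Matrix.add_mul, Matrix.transpose_mul, hPt, Matrix.mul_assoc Gᵀ, hPP,
    Matrix.mul_assoc P G, hG]

theorem frob_projection {P H : Matrix (Fin 3) (Fin 3) ℝ} (hPt : Pᵀ = P) (hH : H * P = H) :
    frob P H = H.trace := by
  rw [frob_eq_trace, hPt, Matrix.trace_mul_comm, hH]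

/-! ### Derivatives of the energies -/

/-- The integral is itself a polynomial in `ε`, so no differentiation under the integral sign is
needed. -/
theorem hasDerivAt_integral_quadratic {X : Type*} [MeasurableSpace X] {μ : Measure X}
    {a b c : X → ℝ} (ha : Integrable a μ) (hb : Integrable b μ) (hc : Integrable c μ) :
    HasDerivAt (fun ε : ℝ => ∫ x, (a x + ε * b x + ε ^ 2 * c x) ∂μ) (∫ x, b x ∂μ) 0 := by
  have h1 : (fun ε : ℝ => ∫ x, (a x + ε * b x + ε ^ 2 * c x) ∂μ) =
      fun ε : ℝ => (∫ x, a x ∂μ) + ε * (∫ x, b x ∂μ) + ε ^ 2 * ∫ x, c x ∂μ := by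
    ext ε
    have h2 : Integrable (fun x => a x + ε * b x) μ := ha.add (hb.const_mul ε)
    rw [integral_add h2 (hc.const_mul _),
      integral_add ha (hb.const_mul ε), integral_const_mul, integral_const_mul]
  rw [h1]
  have h2 := (((hasDerivAt_id (0 : ℝ)).mul_const (∫ x, b x ∂μ)).const_add (∫ x, a x ∂μ)).fun_add
    (((hasDerivAt_id (0 : ℝ)).fun_pow 2).mul_const (∫ x, c x ∂μ))
  exact h2.congr_deriv (by simp)

theorem ContinuousOn.frob {K : Set E3} {D D' : E3 → Matrix (Fin 3) (Fin 3) ℝ}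
    (hD : ∀ i j, ContinuousOn (fun x => D x i j) K)
    (hD' : ∀ i j, ContinuousOn (fun x => D' x i j) K) :
    ContinuousOn (fun x => frob (D x) (D' x)) K :=
  continuousOn_finsetSum _ fun i _ => continuousOn_finsetSum _ fun j _ => (hD i j).mul (hD' i j)

theorem hasDerivAt_setIntegral_dissipation {ν : Measure E3} {S K : Set E3} (hSK : S ⊆ K)
    (hK : IsCompact K) (hν : ν K < ⊤) {μ lam : E3 → ℝ} (hμ : ContinuousOn μ K)
    (hlam : ContinuousOn lam K) {D D' : E3 → Matrix (Fin 3) (Fin 3) ℝ} {d d' : E3 → ℝ}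
    (hD : ∀ i j, ContinuousOn (fun x => D x i j) K)
    (hD' : ∀ i j, ContinuousOn (fun x => D' x i j) K)
    (hd : ContinuousOn d K) (hd' : ContinuousOn d' K) :
    HasDerivAt (fun ε : ℝ => ∫ x in S, (-(μ x / 2) * frob (D x + ε • D' x) (D x + ε • D' x) -
        lam x / 2 * |d x + ε * d' x| ^ 2) ∂ν)
      (∫ x in S, (-(μ x) * frob (D x) (D' x) - lam x * (d x * d' x)) ∂ν) 0 := by
  have hint : ∀ {k : E3 → ℝ}, ContinuousOn k K → IntegrableOn k S ν := fun hk =>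
    integrableOn_of_continuousOn_of_isCompact hSK hK hν hk
  have h1 := hasDerivAt_integral_quadratic (μ := ν.restrict S)
    (a := fun x => -(μ x / 2) * frob (D x) (D x) - lam x / 2 * d x ^ 2)
    (b := fun x => -(μ x) * frob (D x) (D' x) - lam x * (d x * d' x))
    (c := fun x => -(μ x / 2) * frob (D' x) (D' x) - lam x / 2 * d' x ^ 2)
    (hint (((hμ.div_const 2).neg.mul (ContinuousOn.frob hD hD)).sub
      ((hlam.div_const 2).mul (hd.pow 2))))
    (hint ((hμ.neg.mul (ContinuousOn.frob hD hD')).sub (hlam.mul (hd.mul hd'))))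
    (hint (((hμ.div_const 2).neg.mul (ContinuousOn.frob hD' hD')).sub
      ((hlam.div_const 2).mul (hd'.pow 2))))
  convert h1 using 1
  ext ε
  congr 1
  ext x
  rw [sq_abs]
  simp only [frob, Fin.sum_univ_three, Matrix.add_apply, Matrix.smul_apply, smul_eq_mul]
  ring

theorem hasDerivAt_setIntegral_work {ν : Measure E3} {S K : Set E3} (hSK : S ⊆ K)
    (hK : IsCompact K) (hν : ν K < ⊤) {p d d' : E3 → ℝ} (hp : ContinuousOn p K)
    (hd : ContinuousOn d K) (hd' : ContinuousOn d' K) :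
    HasDerivAt (fun ε : ℝ => ∫ x in S, (d x + ε * d' x) * p x ∂ν) (∫ x in S, d' x * p x ∂ν) 0 := by
  have hint : ∀ {k : E3 → ℝ}, ContinuousOn k K → IntegrableOn k S ν := fun hk =>
    integrableOn_of_continuousOn_of_isCompact hSK hK hν hk
  have h1 := hasDerivAt_integral_quadratic (μ := ν.restrict S) (a := fun x => d x * p x)
    (b := fun x => d' x * p x) (c := fun _ => 0) (hint (hd.mul hp)) (hint (hd'.mul hp))
    (integrable_zero _ _ _)
  convert h1 using 1
  ext ε
  congr 1
  ext x
  ring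

theorem contDiff_coord {v : E3 → E3} (hv : ContDiff ℝ ∞ v) (i : Fin 3) :
    ContDiff ℝ ∞ fun x => v x i :=
  (EuclideanSpace.proj (𝕜 := ℝ) i).contDiff.comp hv

theorem partialD_add_smul {v φ : E3 → E3} (hv : ContDiff ℝ ∞ v) (hφ : ContDiff ℝ ∞ φ) (ε : ℝ)
    (i j : Fin 3) (x : E3) :
    partialD j (fun y => (v + ε • φ) y i) x =
      partialD j (fun y => v y i) x + ε * partialD j (fun y => φ y i) x := by
  have h1 : HasFDerivAt (fun y => v y i + ε * φ y i) _ x :=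
    (((contDiff_coord hv i).differentiable (by simp) x).hasFDerivAt).add
      ((((contDiff_coord hφ i).differentiable (by simp) x).hasFDerivAt).const_mul ε)
  change fderiv ℝ (fun y => v y i + ε * φ y i) x (basisVec j) = _
  rw [h1.fderiv]
  simp [partialD]

theorem gradV_add_smul {v φ : E3 → E3} (hv : ContDiff ℝ ∞ v) (hφ : ContDiff ℝ ∞ φ) (ε : ℝ)
    (x : E3) : gradV (v + ε • φ) x = gradV v x + ε • gradV φ x := by
  ext i j
  exact partialD_add_smul hv hφ ε i j x

theorem strain_add_smul {v φ : E3 → E3} (hv : ContDiff ℝ ∞ v) (hφ : ContDiff ℝ ∞ φ) (ε : ℝ)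
    (x : E3) : strain (v + ε • φ) x = strain v x + ε • strain φ x := by
  rw [strain, strain, strain, gradV_add_smul hv hφ, Matrix.transpose_add, Matrix.transpose_smul]
  module

theorem divV_add_smul {v φ : E3 → E3} (hv : ContDiff ℝ ∞ v) (hφ : ContDiff ℝ ∞ φ) (ε : ℝ)
    (x : E3) : divV (v + ε • φ) x = divV v x + ε * divV φ x := by
  simp only [divV, partialD_add_smul hv hφ, Finset.sum_add_distrib, Finset.mul_sum]

theorem contDiff_gradV {v : E3 → E3} (hv : ContDiff ℝ ∞ v) (i j : Fin 3) :
    ContDiff ℝ ∞ fun x => gradV v x i j := contDiff_partialD (contDiff_coord hv i) j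

theorem contDiff_strain {v : E3 → E3} (hv : ContDiff ℝ ∞ v) (i j : Fin 3) :
    ContDiff ℝ ∞ fun x => strain v x i j :=
  contDiff_const.mul ((contDiff_gradV hv i j).add (contDiff_gradV hv j i))

theorem contDiff_divV {v : E3 → E3} (hv : ContDiff ℝ ∞ v) : ContDiff ℝ ∞ fun x => divV v x :=
  ContDiff.sum fun j _ => contDiff_partialD (contDiff_coord hv j) j

theorem contDiff_stress {μ lam p : E3 → ℝ} {v : E3 → E3} (hμ : ContDiff ℝ ∞ μ)
    (hlam : ContDiff ℝ ∞ lam) (hp : ContDiff ℝ ∞ p) (hv : ContDiff ℝ ∞ v) (i j : Fin 3) :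
    ContDiff ℝ ∞ fun x => stress μ lam p v x i j :=
  ((hμ.mul (contDiff_strain hv i j)).add ((hlam.mul (contDiff_divV hv)).mul contDiff_const)).sub
    (hp.mul contDiff_const)

/-- The right side is minus the `ε`-linear part of the energy density. The symmetric strain pairs
with `∇φ` as with its symmetric part, and the identity picks out the trace `div φ`. -/
theorem frob_stress_gradV (μ lam p : E3 → ℝ) (v φ : E3 → E3) (x : E3) :
    frob (stress μ lam p v x) (gradV φ x) =
      μ x * frob (strain v x) (strain φ x) + lam x * (divV v x * divV φ x) - divV φ x * p x := by
  have h1 : (gradV φ x).trace = divV φ x := rfl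
  rw [stress, frob_sub_left, frob_add_left, frob_smul_left, frob_smul_left, frob_smul_left,
    frob_one_left, h1, strain, strain, frob_sum_transpose]
  ring

theorem hasDerivAt_bulk {W : Set E3} (hW : Bornology.IsBounded W) {μ lam p : E3 → ℝ}
    {v φ : E3 → E3} (hμ : ContDiff ℝ ∞ μ) (hlam : ContDiff ℝ ∞ lam) (hp : ContDiff ℝ ∞ p)
    (hv : ContDiff ℝ ∞ v) (hφ : ContDiff ℝ ∞ φ) :
    HasDerivAt (fun ε : ℝ => bulkDissipation W μ lam (v + ε • φ) + bulkWork W p (v + ε • φ))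
      (-∫ x in W, frob (stress μ lam p v x) (gradV φ x)) 0 := by
  have hK := hW.isCompact_closure
  have hν := hK.measure_lt_top (μ := volume)
  have h1 := hasDerivAt_setIntegral_dissipation subset_closure hK hν
    hμ.continuous.continuousOn hlam.continuous.continuousOn
    (fun i j => (contDiff_strain hv i j).continuous.continuousOn)
    (fun i j => (contDiff_strain hφ i j).continuous.continuousOn)
    (contDiff_divV hv).continuous.continuousOn (contDiff_divV hφ).continuous.continuousOn
  have h2 := hasDerivAt_setIntegral_work subset_closure hK hν hp.continuous.continuousOn
    (contDiff_divV hv).continuous.continuousOn (contDiff_divV hφ).continuous.continuousOn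
  have hint : ∀ {k : E3 → ℝ}, Continuous k → IntegrableOn k W := fun hk =>
    integrableOn_of_continuousOn_of_isCompact subset_closure hK hν hk.continuousOn
  refine ((h1.fun_add h2).congr_deriv ?_).congr_of_eventuallyEq
    (Filter.Eventually.of_forall fun ε => ?_)
  rotate_left
  · simp only [bulkDissipation, bulkWork, strain_add_smul hv hφ, divV_add_smul hv hφ]
  · rw [← integral_add, ← integral_neg]
    · congr 1
      ext x
      rw [frob_stress_gradV]
      ring
    · refine hint ((hμ.continuous.neg.mul ?_).sub (hlam.continuous.mul
        ((contDiff_divV hv).continuous.mul (contDiff_divV hφ).continuous)))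
      exact continuous_finsetSum _ fun i _ => continuous_finsetSum _ fun j _ =>
        (contDiff_strain hv i j).continuous.mul (contDiff_strain hφ i j).continuous
    · exact hint ((contDiff_divV hφ).continuous.mul hp.continuous)

/-! ### The surface energy -/

theorem sum_outerNormal_sq {U : Set E3} (hU : IsSmoothBoundedDomain U) {x : E3}
    (hx : x ∈ frontier U) : ∑ k, outerNormal U x k * outerNormal U x k = 1 := by
  have := norm_outerNormal hU hx
  rw [EuclideanSpace.norm_eq, Real.sqrt_eq_one] at this
  rw [← this]
  exact Finset.sum_congr rfl fun k _ => by rw [Real.norm_eq_abs, sq_abs, sq]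

theorem transpose_projTangent (U : Set E3) (x : E3) : (projTangent U x)ᵀ = projTangent U x := by
  ext i j
  simp [projTangent, Matrix.one_apply, mul_comm, eq_comm]

theorem projTangent_eq_sub_vecMulVec (U : Set E3) (x : E3) :
    projTangent U x = 1 - Matrix.vecMulVec (outerNormal U x).ofLp (outerNormal U x).ofLp := rfl

theorem projTangent_mul_self {U : Set E3} (hU : IsSmoothBoundedDomain U) {x : E3}
    (hx : x ∈ frontier U) : projTangent U x * projTangent U x = projTangent U x := by
  have h := sum_outerNormal_sq hU hx
  have h1 : (outerNormal U x).ofLp ⬝ᵥ (outerNormal U x).ofLp = 1 := h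
  rw [projTangent_eq_sub_vecMulVec, Matrix.sub_mul, Matrix.mul_sub, Matrix.mul_sub,
    Matrix.vecMulVec_mul_vecMulVec, h1]
  simp

theorem surfaceD_eq_tangentialD {U : Set E3} (hU : IsSmoothBoundedDomain U) {x : E3}
    (hx : x ∈ frontier U) {f : E3 → ℝ} (hf : ContDiff ℝ ∞ f) (j : Fin 3) :
    surfaceD U j f x = tangentialD (outerNormal U) j f x := by
  rw [surfaceD_eq hU hx (hf.differentiable (by simp) x), tangentialD_eq]

theorem sum_mul_tangentialD {N : E3 → E3} {x : E3} (hN : ∑ k, N x k * N x k = 1) (f : E3 → ℝ) :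
    ∑ k, N x k * tangentialD N k f x = 0 := by
  simp only [tangentialD, Fin.sum_univ_three] at hN ⊢
  linear_combination (-(N x 0 * partialD 0 f x + N x 1 * partialD 1 f x +
    N x 2 * partialD 2 f x)) * hN

theorem mul_one_sub_vecMulVec {G : Matrix (Fin 3) (Fin 3) ℝ} {n : Fin 3 → ℝ}
    (h : ∀ i, ∑ k, n k * G i k = 0) : G * (1 - Matrix.vecMulVec n n) = G := by
  rw [Matrix.mul_sub, Matrix.mul_one, Matrix.mul_vecMulVec]
  have : G *ᵥ n = 0 := by
    ext i
    rw [Matrix.mulVec, dotProduct, Pi.zero_apply, ← h i]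
    exact Finset.sum_congr rfl fun k _ => mul_comm _ _
  rw [this]
  simp

theorem surfGradV_mul_projTangent {U : Set E3} (hU : IsSmoothBoundedDomain U) {x : E3}
    (hx : x ∈ frontier U) {v : E3 → E3} (hv : ContDiff ℝ ∞ v) :
    surfGradV U v x * projTangent U x = surfGradV U v x := by
  refine mul_one_sub_vecMulVec fun i => ?_
  simp only [surfGradV, surfaceD_eq_tangentialD hU hx (contDiff_coord hv i)]
  exact sum_mul_tangentialD (sum_outerNormal_sq hU hx) _

theorem surfGradV_add_smul {U : Set E3} (hU : IsSmoothBoundedDomain U) {x : E3}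
    (hx : x ∈ frontier U) {v φ : E3 → E3} (hv : ContDiff ℝ ∞ v) (hφ : ContDiff ℝ ∞ φ) (ε : ℝ) :
    surfGradV U (v + ε • φ) x = surfGradV U v x + ε • surfGradV U φ x := by
  ext i j
  have hs : ContDiff ℝ ∞ (v + ε • φ) := hv.add (contDiff_const.smul hφ)
  simp only [surfGradV, Matrix.add_apply, Matrix.smul_apply,
    surfaceD_eq_tangentialD hU hx (contDiff_coord hs i),
    surfaceD_eq_tangentialD hU hx (contDiff_coord hv i),
    surfaceD_eq_tangentialD hU hx (contDiff_coord hφ i), tangentialD,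
    partialD_add_smul hv hφ, Fin.sum_univ_three, smul_eq_mul]
  ring

theorem surfStrain_add_smul {U : Set E3} (hU : IsSmoothBoundedDomain U) {x : E3}
    (hx : x ∈ frontier U) {v φ : E3 → E3} (hv : ContDiff ℝ ∞ v) (hφ : ContDiff ℝ ∞ φ) (ε : ℝ) :
    surfStrain U (v + ε • φ) x = surfStrain U v x + ε • surfStrain U φ x := by
  rw [surfStrain, surfStrain, surfStrain, surfGradV_add_smul hU hx hv hφ, Matrix.mul_add,
    Matrix.mul_smul, Matrix.transpose_add, Matrix.transpose_smul]
  module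

theorem surfDivV_eq_trace (U : Set E3) (v : E3 → E3) (x : E3) :
    surfDivV U v x = (surfGradV U v x).trace := rfl

theorem surfDivV_add_smul {U : Set E3} (hU : IsSmoothBoundedDomain U) {x : E3}
    (hx : x ∈ frontier U) {v φ : E3 → E3} (hv : ContDiff ℝ ∞ v) (hφ : ContDiff ℝ ∞ φ) (ε : ℝ) :
    surfDivV U (v + ε • φ) x = surfDivV U v x + ε * surfDivV U φ x := by
  rw [surfDivV_eq_trace, surfGradV_add_smul hU hx hv hφ, Matrix.trace_add, Matrix.trace_smul]
  rfl

theorem continuousOn_surfGradV {U : Set E3} (hU : IsSmoothBoundedDomain U) {v : E3 → E3}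
    (hv : ContDiff ℝ ∞ v) (i j : Fin 3) :
    ContinuousOn (fun x => surfGradV U v x i j) (frontier U) :=
  continuousOn_surfaceD hU ((contDiff_coord hv i).of_le (by simp)) j

theorem continuousOn_projTangent {U : Set E3} (hU : IsSmoothBoundedDomain U) (i j : Fin 3) :
    ContinuousOn (fun x => projTangent U x i j) (frontier U) := by
  have h : ∀ i : Fin 3, ContinuousOn (fun x => outerNormal U x i) (frontier U) := fun i =>
    (EuclideanSpace.proj (𝕜 := ℝ) i).continuous.comp_continuousOn (continuousOn_outerNormal hU)
  exact continuousOn_const.sub ((h i).mul (h j))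

theorem continuousOn_surfStrain {U : Set E3} (hU : IsSmoothBoundedDomain U) {v : E3 → E3}
    (hv : ContDiff ℝ ∞ v) (i j : Fin 3) :
    ContinuousOn (fun x => surfStrain U v x i j) (frontier U) := by
  have h : ∀ i j, ContinuousOn (fun x => (projTangent U x * surfGradV U v x) i j) (frontier U) :=
    fun i j => by
      simp only [Matrix.mul_apply]
      exact continuousOn_finsetSum _ fun k _ =>
        (continuousOn_projTangent hU i k).mul (continuousOn_surfGradV hU hv k j)
  exact continuousOn_const.mul ((h i j).add (h j i))

theorem continuousOn_surfDivV {U : Set E3} (hU : IsSmoothBoundedDomain U) {v : E3 → E3}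
    (hv : ContDiff ℝ ∞ v) : ContinuousOn (fun x => surfDivV U v x) (frontier U) :=
  continuousOn_finsetSum _ fun j _ => continuousOn_surfGradV hU hv j j

theorem frob_surfStress_surfGradV {U : Set E3} (hU : IsSmoothBoundedDomain U) {x : E3}
    (hx : x ∈ frontier U) (μ lam p : E3 → ℝ) {v φ : E3 → E3} (hv : ContDiff ℝ ∞ v)
    (hφ : ContDiff ℝ ∞ φ) :
    frob (surfStress U μ lam p v x) (surfGradV U φ x) =
      μ x * frob (surfStrain U v x) (surfStrain U φ x) +
        lam x * (surfDivV U v x * surfDivV U φ x) - surfDivV U φ x * p x := by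
  have hPt := transpose_projTangent U x
  have hP := projTangent_mul_self hU hx
  rw [surfStress, frob_sub_left, frob_add_left, frob_smul_left, frob_smul_left, frob_smul_left,
    frob_projection hPt (surfGradV_mul_projTangent hU hx hφ), ← surfDivV_eq_trace, surfStrain,
    surfStrain, frob_tangential hPt hP (surfGradV_mul_projTangent hU hx hv)]
  ring

theorem hasDerivAt_surf {U : Set E3} (hU : IsSmoothBoundedDomain U) {μ lam p : E3 → ℝ}
    {v φ : E3 → E3} (hμ : ContDiff ℝ ∞ μ) (hlam : ContDiff ℝ ∞ lam) (hp : ContDiff ℝ ∞ p)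
    (hv : ContDiff ℝ ∞ v) (hφ : ContDiff ℝ ∞ φ) :
    HasDerivAt (fun ε : ℝ => surfDissipation U μ lam (v + ε • φ) + surfWork U p (v + ε • φ))
      (-∫ x in frontier U, frob (surfStress U μ lam p v x) (surfGradV U φ x) ∂μHE[2]) 0 := by
  have hm := (isClosed_frontier (s := U)).measurableSet
  have h1 := hasDerivAt_setIntegral_dissipation subset_rfl hU.isCompact_frontier
    hU.measure_frontier_lt_top hμ.continuous.continuousOn hlam.continuous.continuousOn
    (continuousOn_surfStrain hU hv) (continuousOn_surfStrain hU hφ)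
    (continuousOn_surfDivV hU hv) (continuousOn_surfDivV hU hφ)
  have h2 := hasDerivAt_setIntegral_work subset_rfl hU.isCompact_frontier
    hU.measure_frontier_lt_top hp.continuous.continuousOn
    (continuousOn_surfDivV hU hv) (continuousOn_surfDivV hU hφ)
  refine ((h1.fun_add h2).congr_deriv ?_).congr_of_eventuallyEq
    (Filter.Eventually.of_forall fun ε => ?_)
  · rw [← integral_add, ← integral_neg]
    · refine setIntegral_congr_fun hm fun x hx => ?_
      simp only [frob_surfStress_surfGradV hU hx μ lam p hv hφ]
      ring
    · exact hU.integrableOn_frontier ((hμ.continuous.continuousOn.neg.mul (ContinuousOn.frob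
        (continuousOn_surfStrain hU hv) (continuousOn_surfStrain hU hφ))).sub
        (hlam.continuous.continuousOn.mul
        ((continuousOn_surfDivV hU hv).mul (continuousOn_surfDivV hU hφ))))
    · exact hU.integrableOn_frontier
        ((continuousOn_surfDivV hU hφ).mul hp.continuous.continuousOn)
  · simp only [surfDissipation, surfWork]
    congr 1
    · refine setIntegral_congr_fun hm fun x hx => ?_
      simp only [surfStrain_add_smul hU hx hv hφ, surfDivV_add_smul hU hx hv hφ]
    · refine setIntegral_congr_fun hm fun x hx => ?_
      simp only [surfDivV_add_smul hU hx hv hφ]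

/-- The first variation of the energy. -/
theorem hasDerivAt_energy {U W : Set E3} (hU : IsSmoothBoundedDomain U)
    (hW : Bornology.IsBounded W) {μA lamA pA μB lamB pB μS lamS pS : E3 → ℝ}
    {vA vB vS φA φB φS : E3 → E3}
    (hμA : ContDiff ℝ ∞ μA) (hlamA : ContDiff ℝ ∞ lamA) (hpA : ContDiff ℝ ∞ pA)
    (hμB : ContDiff ℝ ∞ μB) (hlamB : ContDiff ℝ ∞ lamB) (hpB : ContDiff ℝ ∞ pB)
    (hμS : ContDiff ℝ ∞ μS) (hlamS : ContDiff ℝ ∞ lamS) (hpS : ContDiff ℝ ∞ pS)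
    (hvA : ContDiff ℝ ∞ vA) (hvB : ContDiff ℝ ∞ vB) (hvS : ContDiff ℝ ∞ vS)
    (hφA : ContDiff ℝ ∞ φA) (hφB : ContDiff ℝ ∞ φB) (hφS : ContDiff ℝ ∞ φS) :
    HasDerivAt (fun ε : ℝ =>
        energyD U W μA lamA μB lamB μS lamS (vA + ε • φA) (vB + ε • φB) (vS + ε • φS) +
          energyW U W pA pB pS (vA + ε • φA) (vB + ε • φB) (vS + ε • φS))
      (-(∫ x in U, frob (stress μA lamA pA vA x) (gradV φA x)) -
        (∫ x in W, frob (stress μB lamB pB vB x) (gradV φB x)) -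
        ∫ x in frontier U, frob (surfStress U μS lamS pS vS x) (surfGradV U φS x) ∂μHE[2]) 0 := by
  have hA := hasDerivAt_bulk hU.isBounded hμA hlamA hpA hvA hφA
  have hB := hasDerivAt_bulk hW hμB hlamB hpB hvB hφB
  have hS := hasDerivAt_surf hU hμS hlamS hpS hvS hφS
  refine (((hA.fun_add hB).fun_add hS).congr_deriv (by ring)).congr_of_eventuallyEq
    (Filter.Eventually.of_forall fun ε => ?_)
  simp only [energyD, energyW]
  ring

/-! ### Integration by parts in the bulk -/

theorem inner_eq_sum (a b : E3) : inner ℝ a b = ∑ i, a i * b i := by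
  rw [PiLp.inner_apply]
  exact Finset.sum_congr rfl fun i _ => by simp [mul_comm]

theorem contDiff_divM {T : E3 → Matrix (Fin 3) (Fin 3) ℝ}
    (hT : ∀ i j, ContDiff ℝ ∞ fun x => T x i j) : ContDiff ℝ ∞ fun x => divM T x :=
  contDiff_euclidean.2 fun i => by
    change ContDiff ℝ ∞ fun x => ∑ j, partialD j (fun y => T y i j) x
    exact ContDiff.sum fun j _ => contDiff_partialD (hT i j) j

theorem gradV_eq_zero_of_notMem_tsupport {φ : E3 → E3} {x : E3} (hx : x ∉ tsupport φ) :
    gradV φ x = 0 := by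
  ext i j
  refine image_eq_zero_of_notMem_tsupport (f := partialD j fun y => φ y i) fun h => hx ?_
  have hsupp : Function.support (fun y => φ y i) ⊆ Function.support φ := by
    intro y hy hy0
    exact hy (by simp [hy0])
  exact closure_mono hsupp (tsupport_partialD_subset _ j h)

theorem continuous_frob_gradV {T : E3 → Matrix (Fin 3) (Fin 3) ℝ} {φ : E3 → E3}
    (hT : ∀ i j, ContDiff ℝ ∞ fun x => T x i j) (hφ : ContDiff ℝ ∞ φ) :
    Continuous fun x => frob (T x) (gradV φ x) :=
  continuous_finsetSum _ fun i _ => continuous_finsetSum _ fun j _ =>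
    (hT i j).continuous.mul (contDiff_gradV hφ i j).continuous

/-- The product rule for `T_ij φ_i`, with the boundary contribution left as an abstract functional
`β`. It serves three cases: no boundary term, the inner domain, and the outer domain with reversed
sign. -/
theorem setIntegral_frob_gradV {W C : Set E3} {β : Fin 3 → (E3 → ℝ) → ℝ}
    (hβ : ∀ f : E3 → ℝ, ContDiff ℝ ∞ f → HasCompactSupport f → tsupport f ⊆ C → ∀ j,
      ∫ x in W, partialD j f x = β j f)
    {T : E3 → Matrix (Fin 3) (Fin 3) ℝ} (hT : ∀ i j, ContDiff ℝ ∞ fun x => T x i j)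
    {φ : E3 → E3} (hφ : ContDiff ℝ ∞ φ) (hφc : HasCompactSupport φ) (hφC : tsupport φ ⊆ C) :
    ∫ x in W, frob (T x) (gradV φ x) =
      ∑ j, β j (fun x => ∑ i, T x i j * φ x i) - ∫ x in W, inner ℝ (divM T x) (φ x) := by
  have hf : ∀ j, ContDiff ℝ ∞ fun x => ∑ i, T x i j * φ x i := fun j =>
    ContDiff.sum fun i _ => (hT i j).mul (contDiff_coord hφ i)
  have hsupp : ∀ j, Function.support (fun x => ∑ i, T x i j * φ x i) ⊆ Function.support φ := by
    intro j x hx hx0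
    exact hx (by simp [hx0])
  have hfc : ∀ j, HasCompactSupport fun x => ∑ i, T x i j * φ x i := fun j => hφc.mono (hsupp j)
  have h1 : ∀ j, ∫ x in W, partialD j (fun x => ∑ i, T x i j * φ x i) x =
      β j (fun x => ∑ i, T x i j * φ x i) := fun j =>
    hβ _ (hf j) (hfc j) ((closure_mono (hsupp j)).trans hφC) j
  have h2 : ∀ x, ∑ j, partialD j (fun x => ∑ i, T x i j * φ x i) x =
      frob (T x) (gradV φ x) + inner ℝ (divM T x) (φ x) := by
    intro x
    have hd : ∀ i j, partialD j (fun y => T y i j * φ y i) x =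
        partialD j (fun y => T y i j) x * φ x i + T x i j * partialD j (fun y => φ y i) x :=
      fun i j => partialD_mul ((hT i j).differentiable (by simp) x)
        ((contDiff_coord hφ i).differentiable (by simp) x) j
    have hs : ∀ j, partialD j (fun y => ∑ i, T y i j * φ y i) x =
        ∑ i, partialD j (fun y => T y i j * φ y i) x := fun j =>
      partialD_sum (fun i => ((hT i j).mul (contDiff_coord hφ i)).differentiable (by simp) x) j
    simp only [hs, hd]
    simp only [inner_eq_sum, divM, frob, gradV, Fin.sum_univ_three]
    ring
  have hint : Integrable fun x => frob (T x) (gradV φ x) := by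
    refine (continuous_frob_gradV hT hφ).integrable_of_hasCompactSupport ?_
    refine HasCompactSupport.intro hφc fun x hx => ?_
    simp [gradV_eq_zero_of_notMem_tsupport hx, frob]
  have hint' : Integrable fun x => inner ℝ (divM T x) (φ x) := by
    refine ((contDiff_divM hT).continuous.inner hφ.continuous).integrable_of_hasCompactSupport ?_
    refine HasCompactSupport.intro hφc fun x hx => ?_
    simp [image_eq_zero_of_notMem_tsupport hx]
  rw [eq_sub_iff_add_eq, ← integral_add hint.integrableOn hint'.integrableOn]
  simp_rw [← h1, ← h2]
  rw [integral_finsetSum]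
  exact fun j _ => ((contDiff_partialD (hf j) j).continuous.integrable_of_hasCompactSupport
    (hasCompactSupport_partialD (hfc j) j)).integrableOn

theorem setIntegral_frob_gradV_interior {W : Set E3} {T : E3 → Matrix (Fin 3) (Fin 3) ℝ}
    (hT : ∀ i j, ContDiff ℝ ∞ fun x => T x i j)
    {φ : E3 → E3} (hφ : ContDiff ℝ ∞ φ) (hφc : HasCompactSupport φ) (hφW : tsupport φ ⊆ W) :
    ∫ x in W, frob (T x) (gradV φ x) = -∫ x in W, inner ℝ (divM T x) (φ x) := by
  rw [setIntegral_frob_gradV (C := W) (β := fun _ _ => 0) ?_ hT hφ hφc hφW]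
  · simp
  · intro f hf hfc hfW j
    rw [setIntegral_eq_integral_of_forall_compl_eq_zero fun x hx =>
      image_eq_zero_of_notMem_tsupport fun h => hx (hfW (tsupport_partialD_subset f j h))]
    exact integral_partialD_eq_zero (hf.of_le (by simp)) hfc j

theorem contDiff_smul_basisVec {ψ : E3 → ℝ} (hψ : ContDiff ℝ ∞ ψ) (i : Fin 3) :
    ContDiff ℝ ∞ fun x => ψ x • basisVec i := hψ.smul contDiff_const

theorem basisVec_apply (i k : Fin 3) : basisVec i k = if k = i then 1 else 0 := by
  simp [basisVec]

theorem inner_smul_basisVec (a : E3) (c : ℝ) (i : Fin 3) :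
    inner ℝ a (c • basisVec i) = c * a i := by
  rw [inner_smul_right, basisVec, EuclideanSpace.inner_single_right]
  simp

theorem eq_divM_of_forall_setIntegral {W : Set E3} (hW : IsOpen W) (hWb : Bornology.IsBounded W)
    {T : E3 → Matrix (Fin 3) (Fin 3) ℝ} (hT : ∀ i j, ContDiff ℝ ∞ fun x => T x i j)
    {G : E3 → E3} (hG : Continuous G)
    (h : ∀ φ : E3 → E3, ContDiff ℝ ∞ φ → HasCompactSupport φ → tsupport φ ⊆ W →
      -∫ x in W, frob (T x) (gradV φ x) = ∫ x in W, inner ℝ (G x) (φ x)) {x : E3} (hx : x ∈ W) :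
    G x = divM T x := by
  have hdiv := (contDiff_divM hT).continuous
  have hcoord : ∀ {H : E3 → E3}, Continuous H → ∀ i, Continuous fun x => H x i := fun hH i =>
    (EuclideanSpace.proj (𝕜 := ℝ) i).continuous.comp hH
  refine PiLp.ext fun i => sub_eq_zero.1 ?_
  refine eq_zero_of_forall_setIntegral_mul_eq_zero (μ := volume) (S := W) (C := W)
    (k := fun x => G x i - divM T x i) hW hWb.measure_lt_top ?_
    ((hcoord hG i).sub (hcoord hdiv i)) ?_ hx hx
  · intro V hV y hy _ hyV
    exact (hV.inter hW).measure_pos _ ⟨y, hyV, hy⟩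
  · intro ψ hψ hψc hψW
    have hφ := contDiff_smul_basisVec hψ i
    have hφc : HasCompactSupport fun x => ψ x • basisVec i := hψc.smul_right
    have hφW : tsupport (fun x => ψ x • basisVec i) ⊆ W :=
      (tsupport_smul_subset_left ψ _).trans hψW
    have h1 := h _ hφ hφc hφW
    rw [setIntegral_frob_gradV_interior hT hφ hφc hφW, neg_neg] at h1
    simp only [inner_smul_basisVec] at h1
    have hint : ∀ {k : E3 → ℝ}, Continuous k → IntegrableOn (fun x => ψ x * k x) W := fun hk =>
      ((hψ.continuous.mul hk).integrable_of_hasCompactSupport hψc.mul_right).integrableOn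
    simp only [mul_sub]
    rw [integral_sub (hint (hcoord hG i)) (hint (hcoord hdiv i)), h1, sub_self]

/-! ### The surface stress and a smooth extension of it -/

/-- The matrix of the tangential derivatives of `v`, with the normal replaced by a field `N` on
`ℝ³`. -/
noncomputable def extGrad (N v : E3 → E3) (x : E3) : Matrix (Fin 3) (Fin 3) ℝ :=
  fun i j => tangentialD N j (fun y => v y i) x

/-- The projection `I - N ⊗ N`. -/
noncomputable def extProj (N : E3 → E3) (x : E3) : Matrix (Fin 3) (Fin 3) ℝ :=
  1 - Matrix.vecMulVec (N x).ofLp (N x).ofLp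

/-- The surface stress, with the normal replaced by a field `N` on `ℝ³`. -/
noncomputable def extStress (N : E3 → E3) (μ lam p : E3 → ℝ) (v : E3 → E3) (x : E3) :
    Matrix (Fin 3) (Fin 3) ℝ :=
  μ x • ((1 / 2 : ℝ) • (extProj N x * extGrad N v x + (extProj N x * extGrad N v x)ᵀ)) +
    (lam x * (extGrad N v x).trace) • extProj N x - p x • extProj N x

theorem contDiff_tangentialD {N : E3 → E3} (hN : ContDiff ℝ ∞ N) {f : E3 → ℝ}
    (hf : ContDiff ℝ ∞ f) (j : Fin 3) : ContDiff ℝ ∞ (tangentialD N j f) :=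
  (contDiff_partialD hf j).sub ((contDiff_coord hN j).mul
    (ContDiff.sum fun k _ => (contDiff_coord hN k).mul (contDiff_partialD hf k)))

theorem contDiff_extStress {N : E3 → E3} (hN : ContDiff ℝ ∞ N) {μ lam p : E3 → ℝ} {v : E3 → E3}
    (hμ : ContDiff ℝ ∞ μ) (hlam : ContDiff ℝ ∞ lam) (hp : ContDiff ℝ ∞ p) (hv : ContDiff ℝ ∞ v)
    (i j : Fin 3) : ContDiff ℝ ∞ fun x => extStress N μ lam p v x i j := by
  have hG : ∀ i j, ContDiff ℝ ∞ fun x => extGrad N v x i j := fun i j =>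
    contDiff_tangentialD hN (contDiff_coord hv i) j
  have hP : ∀ i j, ContDiff ℝ ∞ fun x => extProj N x i j := fun i j =>
    contDiff_const.sub ((contDiff_coord hN i).mul (contDiff_coord hN j))
  have hPG : ∀ i j, ContDiff ℝ ∞ fun x => (extProj N x * extGrad N v x) i j := fun i j => by
    simp only [Matrix.mul_apply]
    exact ContDiff.sum fun k _ => (hP i k).mul (hG k j)
  have htr : ContDiff ℝ ∞ fun x => (extGrad N v x).trace := ContDiff.sum fun k _ => hG k k
  exact ((hμ.mul (contDiff_const.mul ((hPG i j).add (hPG j i)))).add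
    ((hlam.mul htr).mul (hP i j))).sub (hp.mul (hP i j))

/-- Both the projection and the tangential gradient annihilate `N`, and so does the transposed term,
which ends in the projection. Tangential rows are what the surface divergence theorem requires. -/
theorem extStress_mulVec {N : E3 → E3} {x : E3} (hN : ∑ k, N x k * N x k = 1) (μ lam p : E3 → ℝ)
    (v : E3 → E3) : extStress N μ lam p v x *ᵥ (N x).ofLp = 0 := by
  have hN' : (N x).ofLp ⬝ᵥ (N x).ofLp = 1 := hN
  have hP : extProj N x *ᵥ (N x).ofLp = 0 := by
    rw [extProj, Matrix.sub_mulVec, Matrix.one_mulVec, Matrix.vecMulVec_mulVec, hN']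
    simp
  have hPt : (extProj N x)ᵀ = extProj N x := by
    ext i j
    simp [extProj, Matrix.one_apply, Matrix.vecMulVec_apply, mul_comm, eq_comm]
  have hG : extGrad N v x *ᵥ (N x).ofLp = 0 := by
    ext i
    rw [Matrix.mulVec, dotProduct, Pi.zero_apply, ← sum_mul_tangentialD hN fun y => v y i]
    exact Finset.sum_congr rfl fun k _ => mul_comm _ _
  rw [extStress, Matrix.sub_mulVec, Matrix.add_mulVec, Matrix.smul_mulVec, Matrix.smul_mulVec,
    Matrix.smul_mulVec, Matrix.smul_mulVec, Matrix.add_mulVec, Matrix.transpose_mul, hPt,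
    ← Matrix.mulVec_mulVec, ← Matrix.mulVec_mulVec, hP, hG]
  simp

theorem IsBoundaryChart.sum_normal_sq {U C : Set E3} {N : E3 → E3} (hC : IsBoundaryChart U C N)
    {x : E3} (hx : x ∈ C) : ∑ k, N x k * N x k = 1 := by
  have := hC.norm_normal x hx
  rw [EuclideanSpace.norm_eq, Real.sqrt_eq_one] at this
  rw [← this]
  exact Finset.sum_congr rfl fun k _ => by rw [Real.norm_eq_abs, sq_abs, sq]

theorem IsBoundaryChart.surfStress_eq {U C : Set E3} {N : E3 → E3} (hU : IsSmoothBoundedDomain U)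
    (hC : IsBoundaryChart U C N) {x : E3} (hxC : x ∈ C) (hx : x ∈ frontier U) (μ lam p : E3 → ℝ)
    {v : E3 → E3} (hv : ContDiff ℝ ∞ v) :
    surfStress U μ lam p v x = extStress N μ lam p v x := by
  have hG : surfGradV U v x = extGrad N v x := by
    ext i j
    exact hC.surfaceD_eq_tangentialD hU hxC hx ((contDiff_coord hv i).differentiable (by simp) x)
      (fun _ _ _ => rfl) j
  have hP : projTangent U x = extProj N x := by
    rw [projTangent_eq_sub_vecMulVec, hC.outerNormal_eq x hxC hx]
    rfl
  rw [surfStress, surfStrain, surfDivV_eq_trace, hG, hP]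
  rfl

theorem IsBoundaryChart.surfDivM_surfStress_apply {U C : Set E3} {N : E3 → E3}
    (hU : IsSmoothBoundedDomain U) (hC : IsBoundaryChart U C N) {x : E3} (hxC : x ∈ C)
    (hx : x ∈ frontier U) {μ lam p : E3 → ℝ} {v : E3 → E3} (hμ : ContDiff ℝ ∞ μ)
    (hlam : ContDiff ℝ ∞ lam) (hp : ContDiff ℝ ∞ p) (hv : ContDiff ℝ ∞ v) (i : Fin 3) :
    surfDivM U (surfStress U μ lam p v) x i =
      ∑ j, tangentialD N j (fun y => extStress N μ lam p v y i j) x := by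
  change ∑ j, surfaceD U j (fun y => surfStress U μ lam p v y i j) x = _
  refine Finset.sum_congr rfl fun j _ => ?_
  refine hC.surfaceD_eq_tangentialD hU hxC hx
    ((contDiff_extStress hC.contDiff_normal hμ hlam hp hv i j).differentiable (by simp) x) ?_ j
  intro y hyC hy
  rw [hC.surfStress_eq hU hyC hy μ lam p hv]

/-- Integration by parts on the surface. -/
theorem IsBoundaryChart.setIntegral_frob_surfGradV {U C : Set E3} {N : E3 → E3}
    (hU : IsSmoothBoundedDomain U) (hC : IsBoundaryChart U C N) {μ lam p : E3 → ℝ} {v : E3 → E3}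
    (hμ : ContDiff ℝ ∞ μ) (hlam : ContDiff ℝ ∞ lam) (hp : ContDiff ℝ ∞ p) (hv : ContDiff ℝ ∞ v)
    {ψ : E3 → ℝ} (hψ : ContDiff ℝ ∞ ψ) (hψc : HasCompactSupport ψ) (hψC : tsupport ψ ⊆ C)
    (i : Fin 3) :
    ∫ x in frontier U, frob (surfStress U μ lam p v x)
        (surfGradV U (fun y => ψ y • basisVec i) x) ∂μHE[2] =
      -∫ x in frontier U,
        ψ x * ∑ j, tangentialD N j (fun y => extStress N μ lam p v y i j) x ∂μHE[2] := by
  have hN := hC.contDiff_normal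
  have hT := fun j => contDiff_extStress hN hμ hlam hp hv i j
  -- The tangential field is `ψ` times row `i` of the extended stress. The product rule splits its
  -- divergence into the two sides of the claim.
  have h1 := hC.setIntegral_tangential_divergence hU
    (Y := fun j y => ψ y * extStress N μ lam p v y i j) (fun j => hψ.mul (hT j))
    (fun j => hψc.mul_right) (fun j => tsupport_mul_subset_left.trans hψC) (by
      intro x hx
      have h2 := congrFun (extStress_mulVec (hC.sum_normal_sq hx) μ lam p v) i
      simp only [Matrix.mulVec, dotProduct, Pi.zero_apply] at h2
      simp only [mul_assoc, ← Finset.mul_sum, h2, mul_zero])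
  have hψd : ∀ x, DifferentiableAt ℝ ψ x := fun x => hψ.differentiable (by simp) x
  have hTd : ∀ j x, DifferentiableAt ℝ (fun y => extStress N μ lam p v y i j) x := fun j x =>
    (hT j).differentiable (by simp) x
  have h2 : ∀ j x, tangentialD N j (fun y => ψ y * extStress N μ lam p v y i j) x =
      tangentialD N j ψ x * extStress N μ lam p v x i j +
        ψ x * tangentialD N j (fun y => extStress N μ lam p v y i j) x := by
    intro j x
    simp only [tangentialD, partialD_mul (hψd x) (hTd j x), Fin.sum_univ_three]
    ring
  simp only [h2, Finset.sum_add_distrib] at h1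
  rw [integral_add] at h1
  · rw [eq_neg_iff_add_eq_zero]
    simp only [Finset.mul_sum]
    rw [← h1]
    congr 1
    refine setIntegral_congr_fun isClosed_frontier.measurableSet fun x hx => ?_
    have hφ := contDiff_smul_basisVec hψ i
    have hcoord : ∀ k, (fun y => (ψ y • basisVec i) k) = fun y => (if k = i then 1 else 0) * ψ y := by
      intro k
      ext y
      simp [basisVec_apply]
    have hpd : ∀ k l, partialD l (fun y => (ψ y • basisVec i) k) x =
        (if k = i then 1 else 0) * partialD l ψ x := by
      intro k l
      rw [hcoord k, partialD, fderiv_const_mul (hψd x)]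
      rfl
    by_cases hxC : x ∈ C
    · have hG : ∀ k j, surfGradV U (fun y => ψ y • basisVec i) x k j =
          (if k = i then 1 else 0) * tangentialD N j ψ x := by
        intro k j
        rw [surfGradV, hC.surfaceD_eq_tangentialD hU hxC hx
          ((contDiff_coord hφ k).differentiable (by simp) x) (fun _ _ _ => rfl)]
        simp only [tangentialD, hpd, Fin.sum_univ_three]
        ring
      simp only [frob, hG, hC.surfStress_eq hU hxC hx μ lam p hv]
      fin_cases i <;> simp [Fin.sum_univ_three] <;> ring
    -- Outside `C` the chart does not describe the normal, but there `ψ` vanishes to first order and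
    -- both integrands are zero.
    · have h0 : ∀ l, partialD l ψ x = 0 := fun l =>
        image_eq_zero_of_notMem_tsupport fun h => hxC (hψC (tsupport_partialD_subset ψ l h))
      have hG : ∀ k j, surfGradV U (fun y => ψ y • basisVec i) x k j = 0 := by
        intro k j
        rw [surfGradV, TwoPhase.surfaceD_eq_tangentialD hU hx (contDiff_coord hφ k)]
        simp only [tangentialD, hpd, h0, mul_zero, Finset.sum_const_zero, sub_zero]
      simp [frob, hG, tangentialD, h0]
  · exact hU.integrableOn_frontier (continuous_finsetSum _ fun j _ =>
      (contDiff_tangentialD hN hψ j).continuous.mul (hT j).continuous).continuousOn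
  · exact hU.integrableOn_frontier (continuous_finsetSum _ fun j _ =>
      hψ.continuous.mul (contDiff_tangentialD hN (hT j) j).continuous).continuousOn

/-! ### The balance of forces on the interface -/

/-- The field `m` is the bulk direction paired with `e_i` on the surface, kept general so that both
values of `r` are covered. The hypothesis already carries the bulk forces as stress divergences, so
integration by parts cancels all volume integrals and leaves one surface integral against an
arbitrary `ψ`. -/
theorem IsBoundaryChart.interface_balance {Ω U C : Set E3} {N : E3 → E3}
    (hU : IsSmoothBoundedDomain U) (hΩ : IsOpen Ω) (hC : IsBoundaryChart U C N) (hCΩ : C ⊆ Ω)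
    {TA TB : E3 → Matrix (Fin 3) (Fin 3) ℝ} (hTA : ∀ i j, ContDiff ℝ ∞ fun x => TA x i j)
    (hTB : ∀ i j, ContDiff ℝ ∞ fun x => TB x i j) {μ lam p : E3 → ℝ} {v : E3 → E3}
    (hμ : ContDiff ℝ ∞ μ) (hlam : ContDiff ℝ ∞ lam) (hp : ContDiff ℝ ∞ p) (hv : ContDiff ℝ ∞ v)
    {G : E3 → E3} (hG : Continuous G) {m : E3 → E3} (hm : ContDiff ℝ ∞ m) (i : Fin 3)
    (h : ∀ ψ : E3 → ℝ, ContDiff ℝ ∞ ψ → HasCompactSupport ψ → tsupport ψ ⊆ C →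
      -(∫ x in U, frob (TA x) (gradV (fun y => ψ y • m y) x)) -
          (∫ x in Ω \ closure U, frob (TB x) (gradV (fun y => ψ y • m y) x)) -
          (∫ x in frontier U, frob (surfStress U μ lam p v x)
            (surfGradV U (fun y => ψ y • basisVec i) x) ∂μHE[2]) =
        (∫ x in U, inner ℝ (divM TA x) (ψ x • m x)) +
          (∫ x in Ω \ closure U, inner ℝ (divM TB x) (ψ x • m x)) +
          ∫ x in frontier U, inner ℝ (G x) (ψ x • basisVec i) ∂μHE[2])
    {x : E3} (hxC : x ∈ C) (hx : x ∈ frontier U) :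
    G x i = surfDivM U (surfStress U μ lam p v) x i +
      ∑ j, (∑ k, TB x k j * m x k) * outerNormal U x j -
      ∑ j, (∑ k, TA x k j * m x k) * outerNormal U x j := by
  have hN := hC.contDiff_normal
  have hq : ∀ {T : E3 → Matrix (Fin 3) (Fin 3) ℝ}, (∀ i j, ContDiff ℝ ∞ fun x => T x i j) →
      ∀ j, ContDiff ℝ ∞ fun x => (∑ k, T x k j * m x k) * N x j := fun hT j =>
    (ContDiff.sum fun k _ => (hT k j).mul (contDiff_coord hm k)).mul (contDiff_coord hN j)
  have hqs : ∀ {T : E3 → Matrix (Fin 3) (Fin 3) ℝ}, (∀ i j, ContDiff ℝ ∞ fun x => T x i j) →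
      Continuous fun x => ∑ j, (∑ k, T x k j * m x k) * N x j := fun hT =>
    continuous_finsetSum _ fun j _ => (hq hT j).continuous
  have hd : Continuous fun x => ∑ j, tangentialD N j (fun y => extStress N μ lam p v y i j) x :=
    continuous_finsetSum _ fun j _ =>
      (contDiff_tangentialD hN (contDiff_extStress hN hμ hlam hp hv i j) j).continuous
  have hGi : Continuous fun x => G x i := (EuclideanSpace.proj (𝕜 := ℝ) i).continuous.comp hG
  have key := eq_zero_of_forall_setIntegral_mul_eq_zero (μ := μHE[2]) (S := frontier U)
    (k := fun x => G x i - ((∑ j, tangentialD N j (fun y => extStress N μ lam p v y i j) x +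
      ∑ j, (∑ k, TB x k j * m x k) * N x j) - ∑ j, (∑ k, TA x k j * m x k) * N x j))
    hC.isOpen hU.measure_frontier_lt_top hC.measure_pos
    (hGi.sub ((hd.add (hqs hTB)).sub (hqs hTA))) ?_ hxC hx
  · rw [hC.surfDivM_surfStress_apply hU hxC hx hμ hlam hp hv, hC.outerNormal_eq x hxC hx]
    exact sub_eq_zero.1 key
  · intro ψ hψ hψc hψC
    have hφ : ContDiff ℝ ∞ fun x => ψ x • m x := hψ.smul hm
    have hφc : HasCompactSupport fun x => ψ x • m x := hψc.smul_right
    have hφC : tsupport (fun x => ψ x • m x) ⊆ C := (tsupport_smul_subset_left ψ _).trans hψC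
    have hint : ∀ {k : E3 → ℝ}, Continuous k →
        IntegrableOn (fun x => ψ x * k x) (frontier U) μHE[2] := fun hk =>
      hU.integrableOn_frontier (hψ.continuous.mul hk).continuousOn
    have hlin : ∀ {a b c d : E3 → ℝ}, Continuous a → Continuous b → Continuous c → Continuous d →
        ∫ x in frontier U, ψ x * (a x - ((b x + c x) - d x)) ∂μHE[2] =
          (∫ x in frontier U, ψ x * a x ∂μHE[2]) - ((∫ x in frontier U, ψ x * b x ∂μHE[2]) +
            (∫ x in frontier U, ψ x * c x ∂μHE[2]) - ∫ x in frontier U, ψ x * d x ∂μHE[2]) := by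
      intro a b c d ha hb hc hd
      rw [← integral_add (hint hb) (hint hc)]
      simp only [← mul_add]
      rw [← integral_sub (hint (k := fun x => b x + c x) (by fun_prop)) (hint hd)]
      simp only [← mul_sub]
      rw [← integral_sub (hint ha) (hint (k := fun x => b x + c x - d x) (by fun_prop))]
      simp only [← mul_sub]
    have hsum : ∀ {T : E3 → Matrix (Fin 3) (Fin 3) ℝ}, (∀ i j, ContDiff ℝ ∞ fun x => T x i j) →
        ∑ j, ∫ x in frontier U, (∑ k, T x k j * (ψ x • m x) k) * N x j ∂μHE[2] =
          ∫ x in frontier U, ψ x * ∑ j, (∑ k, T x k j * m x k) * N x j ∂μHE[2] := by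
      intro T hT
      simp only [Finset.mul_sum]
      rw [integral_finsetSum _ fun j _ => by
        simpa only [Finset.mul_sum, IntegrableOn] using hint (hq hT j).continuous]
      refine Finset.sum_congr rfl fun j _ => ?_
      congr 1
      ext y
      simp only [PiLp.smul_apply, smul_eq_mul, Fin.sum_univ_three]
      ring
    have h1 := h ψ hψ hψc hψC
    rw [setIntegral_frob_gradV (β := fun j f => ∫ x in frontier U, f x * N x j ∂μHE[2])
        (fun f hf hfc hfC j => hC.setIntegral_partialD hf hfc hfC j) hTA hφ hφc hφC,
      setIntegral_frob_gradV (β := fun j f => -∫ x in frontier U, f x * N x j ∂μHE[2])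
        (fun f hf hfc hfC j => hC.setIntegral_partialD_exterior hU.isOpen hΩ hCΩ hf hfc hfC j)
        hTB hφ hφc hφC,
      hC.setIntegral_frob_surfGradV hU hμ hlam hp hv hψ hψc hψC, Finset.sum_neg_distrib,
      hsum hTA, hsum hTB] at h1
    simp only [inner_smul_basisVec] at h1
    refine (hlin hGi hd (hqs hTB) (hqs hTA)).trans ?_
    linarith

/-! ### Admissible test fields -/

theorem mulV_apply (M : Matrix (Fin 3) (Fin 3) ℝ) (w : E3) (i : Fin 3) :
    mulV M w i = ∑ j, M i j * w j := rfl

theorem mulV_zero (M : Matrix (Fin 3) (Fin 3) ℝ) : mulV M 0 = 0 := by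
  ext i
  simp [mulV_apply]

theorem mulV_smul (M : Matrix (Fin 3) (Fin 3) ℝ) (c : ℝ) (w : E3) :
    mulV M (c • w) = c • mulV M w := by
  ext i
  simp only [mulV_apply, PiLp.smul_apply, smul_eq_mul, Fin.sum_univ_three]
  ring

theorem mulV_projTangent_outerNormal {U : Set E3} (hU : IsSmoothBoundedDomain U) {x : E3}
    (hx : x ∈ frontier U) : mulV (projTangent U x) (outerNormal U x) = 0 := by
  have hn : (outerNormal U x).ofLp ⬝ᵥ (outerNormal U x).ofLp = 1 := sum_outerNormal_sq hU hx
  rw [mulV, projTangent_eq_sub_vecMulVec, Matrix.sub_mulVec, Matrix.one_mulVec,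
    Matrix.vecMulVec_mulVec, hn]
  simp

theorem isAdmissible_interior_left (r : ℝ) (Ω : Set E3) {U : Set E3} (hU : IsOpen U) {φ : E3 → E3}
    (hφ : ContDiff ℝ ∞ φ) (hφU : tsupport φ ⊆ U) :
    IsAdmissible r Ω U φ (fun _ => 0) (fun _ => 0) := by
  have h0 : ∀ x ∈ frontier U, φ x = 0 := fun x hx =>
    image_eq_zero_of_notMem_tsupport fun h =>
      (hU.inter_frontier_eq ▸ (⟨hφU h, hx⟩ : x ∈ U ∩ frontier U) : x ∈ (∅ : Set E3))
  refine ⟨hφ, contDiff_const, contDiff_const, fun _ _ => rfl, ?_, fun _ _ => rfl, ?_, ?_⟩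
  · intro x hx
    rw [h0 x hx]
  · intro x hx
    rw [h0 x hx]
  · intro x _
    rw [mulV_zero, smul_zero]

theorem isAdmissible_interior_right (r : ℝ) {Ω U : Set E3} (hΩ : IsOpen Ω) {φ : E3 → E3}
    (hφ : ContDiff ℝ ∞ φ) (hφU : tsupport φ ⊆ Ω \ closure U) :
    IsAdmissible r Ω U (fun _ => 0) φ (fun _ => 0) := by
  have h0 : ∀ x ∈ frontier U, φ x = 0 := fun x hx =>
    image_eq_zero_of_notMem_tsupport fun h => (hφU h).2 (frontier_subset_closure hx)
  refine ⟨contDiff_const, hφ, contDiff_const, ?_, ?_, ?_, ?_, ?_⟩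
  · intro x hx
    exact image_eq_zero_of_notMem_tsupport fun h =>
      (hΩ.inter_frontier_eq ▸ (⟨(hφU h).1, hx⟩ : x ∈ Ω ∩ frontier Ω) : x ∈ (∅ : Set E3))
  · intro x hx
    rw [h0 x hx]
  · intro x hx
    rw [h0 x hx]
  · intro x hx
    rw [h0 x hx]
  · intro x hx
    rw [h0 x hx, mulV_zero, smul_zero]

/-- One field `ψ m` serves both bulk phases. The coupling conditions are linear, so they need
checking for `m` and `q` only inside `C`, where `ψ` may be nonzero. -/
theorem isAdmissible_of_tsupport_subset {r : ℝ} {Ω U C : Set E3} (hΩ : IsOpen Ω) (hCΩ : C ⊆ Ω)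
    {ψ : E3 → ℝ} (hψ : ContDiff ℝ ∞ ψ) (hψC : tsupport ψ ⊆ C) {m q : E3 → E3}
    (hm : ContDiff ℝ ∞ m) (hq : ContDiff ℝ ∞ q)
    (hn : ∀ x ∈ C, x ∈ frontier U →
      inner ℝ (m x) (outerNormal U x) = inner ℝ (q x) (outerNormal U x))
    (ht : ∀ x ∈ C, x ∈ frontier U →
      mulV (projTangent U x) (m x) = r • mulV (projTangent U x) (q x)) :
    IsAdmissible r Ω U (fun x => ψ x • m x) (fun x => ψ x • m x) (fun x => ψ x • q x) := by
  have h0 : ∀ x ∉ C, ψ x = 0 := fun x hx =>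
    image_eq_zero_of_notMem_tsupport fun h => hx (hψC h)
  refine ⟨hψ.smul hm, hψ.smul hm, hψ.smul hq, ?_, fun _ _ => rfl, ?_, fun _ _ => rfl, ?_⟩
  · intro x hx
    rw [h0 x fun h =>
      (hΩ.inter_frontier_eq ▸ (⟨hCΩ h, hx⟩ : x ∈ Ω ∩ frontier Ω) : x ∈ (∅ : Set E3)), zero_smul]
  · intro x hx
    by_cases hxC : x ∈ C
    · simp only [inner_smul_left, hn x hxC hx]
    · simp [h0 x hxC]
  · intro x hx
    by_cases hxC : x ∈ C
    · rw [mulV_smul, mulV_smul, ht x hxC hx, smul_comm]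
    · simp [h0 x hxC, mulV_zero]

/-! ### The interface stress -/

/-- The scalar interface stress is `n · T n`: the symmetrized gradient has the same quadratic form
as the gradient, and `|n| = 1` handles the multiples of the identity. The right side is what
`interface_balance` produces for `m = n_i n`. -/
theorem mulV_interfaceStress_zero_apply {U : Set E3} (hU : IsSmoothBoundedDomain U)
    (μ lam p : E3 → ℝ) (v : E3 → E3) {x : E3} (hx : x ∈ frontier U) (i : Fin 3) :
    mulV (interfaceStress 0 U μ lam p v x) (outerNormal U x) i =
      ∑ j, (∑ k, stress μ lam p v x k j * (outerNormal U x i * outerNormal U x k)) *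
        outerNormal U x j := by
  have hn := sum_outerNormal_sq hU hx
  rw [interfaceStress, if_pos rfl, mulV, Matrix.smul_mulVec, Matrix.one_mulVec]
  change _ * outerNormal U x i = _
  have h1 : ∑ j, (∑ k, stress μ lam p v x k j * (outerNormal U x i * outerNormal U x k)) *
        outerNormal U x j = (μ x * normalNormalD U v x + (lam x * divV v x - p x) *
          ∑ k, outerNormal U x k * outerNormal U x k) * outerNormal U x i := by
    simp only [stress, strain, normalNormalD, gradV, Matrix.sub_apply, Matrix.add_apply,
      Matrix.smul_apply, Matrix.transpose_apply, smul_eq_mul, Fin.sum_univ_three, Matrix.one_apply]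
    simp
    ring
  rw [h1, hn]
  ring

theorem mulV_interfaceStress_one_apply (U : Set E3) (μ lam p : E3 → ℝ) (v : E3 → E3) (x : E3)
    (i : Fin 3) :
    mulV (interfaceStress 1 U μ lam p v x) (outerNormal U x) i =
      ∑ j, (∑ k, stress μ lam p v x k j * basisVec i k) * outerNormal U x j := by
  rw [interfaceStress, if_neg one_ne_zero, mulV_apply]
  simp [basisVec_apply]

/-! ### The Euler-Lagrange equations at a fixed time -/

theorem contDiff_of_uncurry {F : Type*} [NormedAddCommGroup F] [NormedSpace ℝ F] {f : ℝ → E3 → F}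
    (hf : ContDiff ℝ ∞ (Function.uncurry f)) (t : ℝ) : ContDiff ℝ ∞ (f t) :=
  hf.comp (contDiff_const.prodMk contDiff_id)

theorem gradV_zero : gradV (fun _ => (0 : E3)) = 0 := by
  ext x i j
  simp [gradV, partialD]

theorem surfGradV_zero (U : Set E3) : surfGradV U (fun _ => (0 : E3)) = 0 := by
  ext x i j
  simp [surfGradV, surfaceD]

theorem interface_force_eq {r : ℝ} (hr : r = 0 ∨ r = 1) {Ω U : Set E3} (hΩ : IsOpen Ω)
    (hU : IsSmoothBoundedDomain U) (hUΩ : closure U ⊆ Ω)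
    {μA lamA pA μB lamB pB μS lamS pS : E3 → ℝ} {vA vB vS : E3 → E3}
    (hTA : ∀ i j, ContDiff ℝ ∞ fun x => stress μA lamA pA vA x i j)
    (hTB : ∀ i j, ContDiff ℝ ∞ fun x => stress μB lamB pB vB x i j)
    (hμS : ContDiff ℝ ∞ μS) (hlamS : ContDiff ℝ ∞ lamS) (hpS : ContDiff ℝ ∞ pS)
    (hvS : ContDiff ℝ ∞ vS) {G : E3 → E3} (hG : Continuous G)
    (h : ∀ φA φB φS : E3 → E3, IsAdmissible r Ω U φA φB φS →
      -(∫ x in U, frob (stress μA lamA pA vA x) (gradV φA x)) -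
          (∫ x in Ω \ closure U, frob (stress μB lamB pB vB x) (gradV φB x)) -
          (∫ x in frontier U, frob (surfStress U μS lamS pS vS x) (surfGradV U φS x) ∂μHE[2]) =
        (∫ x in U, inner ℝ (divM (stress μA lamA pA vA) x) (φA x)) +
          (∫ x in Ω \ closure U, inner ℝ (divM (stress μB lamB pB vB) x) (φB x)) +
          ∫ x in frontier U, inner ℝ (G x) (φS x) ∂μHE[2])
    {x : E3} (hx : x ∈ frontier U) :
    G x = surfDivM U (surfStress U μS lamS pS vS) x
      + mulV (interfaceStress r U μB lamB pB vB x) (outerNormal U x)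
      - mulV (interfaceStress r U μA lamA pA vA x) (outerNormal U x) := by
  obtain ⟨C', N, hxC', hC'⟩ := hU.exists_isBoundaryChart hx
  -- Shrinking the chart into `Ω` makes the test fields vanish on the outer boundary.
  have hC := hC'.mono (hC'.isOpen.inter hΩ) inter_subset_left
  have hxC : x ∈ C' ∩ Ω := ⟨hxC', hUΩ (frontier_subset_closure hx)⟩
  have hN := hC.contDiff_normal
  ext i
  rcases hr with rfl | rfl
  · have h1 := hC.interface_balance hU hΩ inter_subset_right hTA hTB hμS hlamS hpS hvS hG
      -- For `r = 0` bulk fields have no tangential part on the interface, so `e_i` is paired with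
      -- its normal part `N_i N`.
      (m := fun y => N y i • N y) ((contDiff_coord hN i).smul hN) i
      (fun ψ hψ _ hψC => h _ _ _ (isAdmissible_of_tsupport_subset hΩ inter_subset_right hψ hψC
        ((contDiff_coord hN i).smul hN) contDiff_const ?_ ?_)) hxC hx
    · rw [h1, PiLp.sub_apply, PiLp.add_apply, mulV_interfaceStress_zero_apply hU _ _ _ _ hx,
        mulV_interfaceStress_zero_apply hU _ _ _ _ hx, hC.outerNormal_eq x hxC hx]
      rfl
    · intro y hyC hy
      rw [hC.outerNormal_eq y hyC hy, inner_smul_left, real_inner_self_eq_norm_sq,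
        hC.norm_normal y hyC, basisVec, EuclideanSpace.inner_single_left]
      simp
    · intro y hyC hy
      rw [← hC.outerNormal_eq y hyC hy, mulV_smul, mulV_projTangent_outerNormal hU hy]
      simp
  · have h1 := hC.interface_balance hU hΩ inter_subset_right hTA hTB hμS hlamS hpS hvS hG
      -- For `r = 1` the three fields agree on the interface, so the same `e_i` is used everywhere.
      (m := fun _ => basisVec i) contDiff_const i
      (fun ψ hψ _ hψC => h _ _ _ (isAdmissible_of_tsupport_subset hΩ inter_subset_right hψ hψC
        contDiff_const contDiff_const (fun _ _ _ => rfl) fun _ _ _ => (one_smul _ _).symm)) hxC hx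
    rw [h1, PiLp.sub_apply, PiLp.add_apply, mulV_interfaceStress_one_apply,
      mulV_interfaceStress_one_apply]

end TwoPhase

open TwoPhase

theorem theorem2p6
    (r : ℝ) (hr : r = 0 ∨ r = 1) (T t : ℝ) (ht : 0 < t) (htT : t < T)
    (Ω : Set E3) (hΩ : IsSmoothBoundedDomain Ω)
    (ΩA : ℝ → Set E3)
    (hΩA : ∀ s ∈ Ico 0 T, IsSmoothBoundedDomain (ΩA s) ∧ closure (ΩA s) ⊆ Ω)
    (ΩB : ℝ → Set E3) (hΩB : ∀ s, ΩB s = Ω \ closure (ΩA s))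
    (Γ : ℝ → Set E3) (hΓ : ∀ s, Γ s = frontier (ΩA s))
    (vA vB vS : ℝ → E3 → E3)
    (hvA : ContDiff ℝ ∞ (Function.uncurry vA)) (hvB : ContDiff ℝ ∞ (Function.uncurry vB))
    (hvS : ContDiff ℝ ∞ (Function.uncurry vS))
    (μA lamA pA μB lamB pB μS lamS pS : ℝ → E3 → ℝ)
    (hμA : ContDiff ℝ ∞ (Function.uncurry μA)) (hlamA : ContDiff ℝ ∞ (Function.uncurry lamA))
    (hpA : ContDiff ℝ ∞ (Function.uncurry pA))
    (hμB : ContDiff ℝ ∞ (Function.uncurry μB)) (hlamB : ContDiff ℝ ∞ (Function.uncurry lamB))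
    (hpB : ContDiff ℝ ∞ (Function.uncurry pB))
    (hμS : ContDiff ℝ ∞ (Function.uncurry μS)) (hlamS : ContDiff ℝ ∞ (Function.uncurry lamS))
    (hpS : ContDiff ℝ ∞ (Function.uncurry pS))
    (FA FB FS : E3 → E3) (hFA : Continuous FA) (hFB : Continuous FB) (hFS : Continuous FS)
    (hvar : ∀ φA φB φS : E3 → E3, IsAdmissible r Ω (ΩA t) φA φB φS →
      HasDerivAt
        (fun ε : ℝ =>
          energyD (ΩA t) (ΩB t) (μA t) (lamA t) (μB t) (lamB t) (μS t) (lamS t)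
              (vA t + ε • φA) (vB t + ε • φB) (vS t + ε • φS)
            + energyW (ΩA t) (ΩB t) (pA t) (pB t) (pS t)
              (vA t + ε • φA) (vB t + ε • φB) (vS t + ε • φS))
        ((∫ x in ΩA t, inner ℝ (FA x) (φA x)) + (∫ x in ΩB t, inner ℝ (FB x) (φB x))
          + ∫ x in Γ t, inner ℝ (FS x) (φS x) ∂μHE[2])
        0) :
    (∀ x ∈ ΩA t, FA x = divM (stress (μA t) (lamA t) (pA t) (vA t)) x) ∧
    (∀ x ∈ ΩB t, FB x = divM (stress (μB t) (lamB t) (pB t) (vB t)) x) ∧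
    (∀ x ∈ Γ t, FS x = surfDivM (ΩA t) (surfStress (ΩA t) (μS t) (lamS t) (pS t) (vS t)) x
      + mulV (interfaceStress r (ΩA t) (μB t) (lamB t) (pB t) (vB t) x) (outerNormal (ΩA t) x)
      - mulV (interfaceStress r (ΩA t) (μA t) (lamA t) (pA t) (vA t) x) (outerNormal (ΩA t) x)) := by
  obtain ⟨hU, hUΩ⟩ := hΩA t ⟨ht.le, htT⟩
  rw [hΩB t, hΓ t] at *
  have hTA := fun i j => contDiff_stress (contDiff_of_uncurry hμA t) (contDiff_of_uncurry hlamA t)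
    (contDiff_of_uncurry hpA t) (contDiff_of_uncurry hvA t) i j
  have hTB := fun i j => contDiff_stress (contDiff_of_uncurry hμB t) (contDiff_of_uncurry hlamB t)
    (contDiff_of_uncurry hpB t) (contDiff_of_uncurry hvB t) i j
  have hWo : IsOpen (Ω \ closure (ΩA t)) := hΩ.isOpen.sdiff isClosed_closure
  have hWb : Bornology.IsBounded (Ω \ closure (ΩA t)) := hΩ.isBounded.subset sdiff_subset
  -- The computed first variation and the assumed one are derivatives of the same function at `0`,
  -- hence equal. This is the weak form from which everything is read off.
  have h := fun φA φB φS (hφ : IsAdmissible r Ω (ΩA t) φA φB φS) =>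
    (hasDerivAt_energy hU hWb (contDiff_of_uncurry hμA t) (contDiff_of_uncurry hlamA t)
      (contDiff_of_uncurry hpA t) (contDiff_of_uncurry hμB t) (contDiff_of_uncurry hlamB t)
      (contDiff_of_uncurry hpB t) (contDiff_of_uncurry hμS t) (contDiff_of_uncurry hlamS t)
      (contDiff_of_uncurry hpS t) (contDiff_of_uncurry hvA t) (contDiff_of_uncurry hvB t)
      (contDiff_of_uncurry hvS t) hφ.smoothA hφ.smoothB hφ.smoothS).unique (hvar φA φB φS hφ)
  have hA : ∀ x ∈ ΩA t, FA x = divM (stress (μA t) (lamA t) (pA t) (vA t)) x := by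
    refine fun x hx => eq_divM_of_forall_setIntegral hU.isOpen hU.isBounded hTA hFA
      (fun φ hφ _ hφU => ?_) hx
    have h1 := h _ _ _ (isAdmissible_interior_left r Ω hU.isOpen hφ hφU)
    simpa [gradV_zero, surfGradV_zero, frob] using h1
  have hB : ∀ x ∈ Ω \ closure (ΩA t),
      FB x = divM (stress (μB t) (lamB t) (pB t) (vB t)) x := by
    refine fun x hx => eq_divM_of_forall_setIntegral hWo hWb hTB hFB (fun φ hφ _ hφW => ?_) hx
    have h1 := h _ _ _ (isAdmissible_interior_right r hΩ.isOpen hφ hφW)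
    simpa [gradV_zero, surfGradV_zero, frob] using h1
  refine ⟨hA, hB, fun x hx => interface_force_eq hr hΩ.isOpen hU hUΩ hTA hTB
    (contDiff_of_uncurry hμS t) (contDiff_of_uncurry hlamS t) (contDiff_of_uncurry hpS t)
    (contDiff_of_uncurry hvS t) hFS (fun φA φB φS hφ => ?_) hx⟩
  -- The bulk equations just obtained replace the bulk forces by stress divergences, the form in
  -- which the volume terms cancel.
  rw [h φA φB φS hφ,
    setIntegral_congr_fun hU.isOpen.measurableSet fun x hx => by rw [hA x hx],
    setIntegral_congr_fun hWo.measurableSet fun x hx => by rw [hB x hx]]
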